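/- Let $A\in\mathbb R^{n\times n}$, $B\in\mathbb R^{n\times m}$, and let $Q\in\mathbb R^{n\times n}$, $R\in\mathbb R^{m\times m}$, $\Sigma_w\in\mathbb R^{n\times n}$ be symmetric with $\beta_0 I\preceq Q\preceq\beta_1 I$, $\beta_0 I\preceq R\preceq\beta_1 I$, $\Sigma_w\succeq\sigma_w^2 I$, where $0<\beta_0$, $\beta_1\le 1$, $\sigma_w>0$. Call $K\in\mathbb R^{m\times n}$ stabilizing if all eigenvalues of $A+BK$ have modulus $<1$; for such $K$ let $\Sigma_K\succ0$ be the solution of $\Sigma_K=\Sigma_w+(A+BK)\Sigma_K(A+BK)^\top$ and let $J(K)=\operatorname{trace}\big((Q+K^\top RK)\Sigma_K\big)$ be the LQR cost of the policy $u_t=Kx_t$ for $x_{t+1}=Ax_t+Bu_t+w_t$ with noise covariance $\Sigma_w$. Let $J^\star=\inf J(K)$ over stabilizing $K$. Let $\psi\ge1$ with $\|B\|\le\psi$ (spectral norm), let $\bar J>0$ with $J^\star\le\bar J/4$, and put $\mathcal K=\{K \text{ stabilizing}: J(K)\le\bar J\}$. Below, $\nabla J$ is the gradient and $\|\cdot\|$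 the norm for the Frobenius inner product on $\mathbb R^{m\times n}$. Set $$\zeta=\sqrt{\tfrac{\bar J}{\beta_0\sigma_w^2}},\quad \mu=\frac{2\bar J}{\zeta^4},\quad L=\frac{112\sqrt n\,\bar J\psi^2\zeta^8}{\beta_0},\quad G=\frac{2\bar J}{\beta_0\sigma_w^2}\sqrt{(\sigma_w^2+\psi^2\bar J)\bar J},\quad D=\frac1{\psi\zeta^3}.$$ Let $T\ge1$, $0<\eta<\min\{D/G,\,1/(4L)\}$, $\gamma=\sqrt{1-\mu\eta}$ and $K_0\in\mathcal K$. Let $n_0,n_1,\dots$ be independent random matrices in $\mathbb R^{m\times n}$ with $\mathbb E[n_t]=0$, $\mathbb E\|n_t\|^2=\sigma_N^2$ for all $t$, and $\|n_t\|\le\Delta$ almost surely for $0\le t\le T-1$. Let $$\sigma_{lb}^2=G^2\Delta^2\max\Big\{\frac{\eta^2}{(D-G\eta)^2},\frac{2}{\mu\bar J}\Big\},\qquad \bar\sigma_p>0,\qquad \bar\sigma_p^2\ge\sigma_{lb}^2 .$$ Define the power allocation $\sigma_0,\dots,\sigma_{T-1}\ge0$ (CtG) by $$t_s=\min\Big\{0\le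 t\le T-1:\ \gamma^{T-1-t}\ge\frac{1-\gamma^{T-t}}{1-\gamma}\cdot\frac{\sigma_{lb}^2}{T\bar\sigma_p^2-t\sigma_{lb}^2}\Big\},$$ $\sigma_t^2=\sigma_{lb}^2$ for $t<t_s$, and $\sigma_t^2=\dfrac{\gamma^{T-1-t}}{\sum_{\ell=t_s}^{T-1}\gamma^{T-\ell-1}}\,(T\bar\sigma_p^2-t_s\sigma_{lb}^2)$ for $t_s\le t\le T-1$. Run policy gradient over the noisy channel, $$K_{t+1}=K_t-\eta\,\frac{G}{\sigma_t}\Big(\sigma_t\frac{\nabla J(K_t)}{G}+n_t\Big),\qquad 0\le t\le T-1 .$$ Then almost surely $K_t\in\mathcal K$ for all $0\le t\le T$, the random variable $J(K_T)$ is integrable, and $$\mathbb E[J(K_T)-J^\star]\le(1-\mu\eta)^T\,(J(K_0)-J^\star)+LG^2\eta^2\sigma_N^2\left(\frac{\sum_{t=0}^{t_s-1}\gamma^{2(T-t-1)}}{\sigma_{lb}^2}+\frac{\Big(\sum_{t=t_s}^{T-1}\gamma^{T-t-1}\Big)^2}{T\bar\sigma_p^2-t_s\sigma_{lb}^2}\right),$$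 where the first fraction is $0$ when $t_s=0$. -/

import Mathlib

open MeasureTheory ProbabilityTheory

noncomputable section

namespace LQRPower

/-- Feedback gains `K ∈ ℝ^{m × n}` with the Frobenius inner product and Frobenius norm,
realized as the Euclidean space over the index set of the matrix entries. -/
abbrev Gain (m n : ℕ) : Type := EuclideanSpace ℝ (Fin m × Fin n)

/-- A gain, read as an `m × n` matrix. -/
def Gain.toMat {m n : ℕ} (K : Gain m n) : Matrix (Fin m) (Fin n) ℝ :=
  Matrix.of fun i j => K (i, j)

open scoped Matrix.Norms.L2Operator in
/-- Spectral norm (largest singular value) of a real matrix. -/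
def spectralNorm {k l : ℕ} (M : Matrix (Fin k) (Fin l) ℝ) : ℝ := ‖M‖

/-- All complex eigenvalues of the real matrix `M` lie in the open unit disc. -/
def IsSchurStable {n : ℕ} (M : Matrix (Fin n) (Fin n) ℝ) : Prop :=
  ∀ z ∈ spectrum ℂ (M.map ((↑) : ℝ → ℂ)), ‖z‖ < 1

open Classical in
/-- The positive definite solution `S` of `S = W + M S Mᵀ` (zero if there is none).
If `W` is positive definite and `M` is Schur stable, it exists and is unique. -/
def lyapunovSolution {n : ℕ} (M W : Matrix (Fin n) (Fin n) ℝ) : Matrix (Fin n) (Fin n) ℝ :=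
  if h : ∃ S : Matrix (Fin n) (Fin n) ℝ, S.PosDef ∧ S = W + M * S * M.transpose then h.choose
  else 0

/-- Data of an LQR problem: `x_{t+1} = A x_t + B u_t + w_t`, where `W` is the covariance of `w_t`,
with stage cost `xᵀ Q x + uᵀ R u`. -/
structure LQR (n m : ℕ) where
  A : Matrix (Fin n) (Fin n) ℝ
  B : Matrix (Fin n) (Fin m) ℝ
  Q : Matrix (Fin n) (Fin n) ℝ
  R : Matrix (Fin m) (Fin m) ℝ
  W : Matrix (Fin n) (Fin n) ℝ

namespace LQR

variable {n m : ℕ}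

/-- Closed-loop matrix `A + B K`. -/
def closedLoop (S : LQR n m) (K : Gain m n) : Matrix (Fin n) (Fin n) ℝ := S.A + S.B * K.toMat

/-- `K` is stabilizing. -/
def Stabilizing (S : LQR n m) (K : Gain m n) : Prop := IsSchurStable (S.closedLoop K)

/-- Stationary state covariance `Σ_K` under `u_t = K x_t`. -/
def stateCov (S : LQR n m) (K : Gain m n) : Matrix (Fin n) (Fin n) ℝ :=
  lyapunovSolution (S.closedLoop K) S.W

/-- `J(K) = trace ((Q + Kᵀ R K) Σ_K)`. It is meaningful for stabilizing `K` (for the others the cost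
is infinite); stability is required separately wherever the cost is used. -/
def cost (S : LQR n m) (K : Gain m n) : ℝ :=
  ((S.Q + K.toMat.transpose * S.R * K.toMat) * S.stateCov K).trace

/-- Optimal value `J⋆`: the infimum of `J` over the stabilizing gains. -/
def optCost (S : LQR n m) : ℝ := sInf (S.cost '' {K | S.Stabilizing K})

/-- The feasible set `{K : J(K) ≤ Jbar}`. -/
def feasible (S : LQR n m) (Jbar : ℝ) : Set (Gain m n) :=
  {K | S.Stabilizing K ∧ S.cost K ≤ Jbar}

end LQR

section Allocation

/-- `γ = √(1 - μ η)`. -/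
def gam (μ η : ℝ) : ℝ := √(1 - μ * η)

/-- The switching time of the `CtG` allocation; `pSq` is the average power budget and `lbSq`
the lower bound on the power. -/
def ctgSwitch (T : ℕ) (pSq μ η lbSq : ℝ) : ℕ :=
  sInf {t : ℕ | t < T ∧
    gam μ η ^ (T - 1 - t) ≥
      (1 - gam μ η ^ (T - t)) / (1 - gam μ η) * (lbSq / (T * pSq - t * lbSq))}

/-- The power `σ_t²` that the `CtG` allocation assigns to time `t < T`. -/
def ctgPowerSq (T : ℕ) (pSq μ η lbSq : ℝ) (t : ℕ) : ℝ :=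
  if t < ctgSwitch T pSq μ η lbSq then lbSq
  else gam μ η ^ (T - 1 - t) /
      (∑ l ∈ Finset.Ico (ctgSwitch T pSq μ η lbSq) T, gam μ η ^ (T - l - 1)) *
    (T * pSq - ctgSwitch T pSq μ η lbSq * lbSq)

/-- The amplitudes `σ_t` of the `CtG` allocation. -/
def ctg (T : ℕ) (pSq μ η lbSq : ℝ) (t : ℕ) : ℝ := √(ctgPowerSq T pSq μ η lbSq t)

end Allocation

section Descent

variable {E : Type*} [NormedAddCommGroup E] [InnerProductSpace ℝ E] [CompleteSpace E]

/-- Transmitted signal for the gradient `g` with amplitude `s`. -/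
def enc (G s : ℝ) (g : E) : E := s • (G⁻¹ • g)

/-- Decoded value of the received signal `y`. -/
def dec (G s : ℝ) (y : E) : E := (G / s) • y

/-- Power-allocated gradient descent on `f` with step size `η`, gradient normalization `G`,
amplitudes `s`, initial point `x₀` and channel noise `ν`. -/
def pagd (f : E → ℝ) (G η : ℝ) (s : ℕ → ℝ) (x₀ : E) (ν : ℕ → E) : ℕ → E
  | 0 => x₀
  | t + 1 => pagd f G η s x₀ ν t -
      η • dec G (s t) (enc G (s t) (gradient f (pagd f G η s x₀ ν t)) + ν t)

end Descent

end LQRPower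

end

/-! After decoding, each update is a gradient step with additive error $e_t=(G/\sigma_t)n_t$. The
theorem is therefore inexact gradient descent on a sublevel set, and three facts carry it.

Gradient domination (`Bounded.gradient_domination`). With $P_K$ the value matrix and $E_K$ the
factor in $\nabla J=2E_K\Sigma_K$, `Bounded.cost_sub` writes $J(K+\Delta)-J(K)$ exactly as a
quadratic in $\Delta$ traced against $\Sigma_{K+\Delta}$. Completing the square in $\Delta$ bounds
$J(K)-J(K')$ by a multiple of $\|\nabla J(K)\|^2$, uniformly over comparison gains $K'$ of cost at
most $\bar J$.

Quadratic upper bound (`Bounded.abs_cost_sub_inner_le`). The same expansion is compared with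
$\langle\nabla J(K),\Delta\rangle$. The only nontrivial input is
$|\Sigma_{K+\Delta}-\Sigma_K|\preceq 6\psi\|\Delta\|\zeta^3\,\Sigma_K$ in the sense of quadratic
forms. It holds because $\Sigma_K$ is a Lyapunov function contracted by the factor $1-\zeta^{-2}$, a
contraction that survives small $\Delta$. Hence stability of $K+\Delta$ is a conclusion, and no path
inside the feasible set is needed.

Invariance (`Bounded.feasible_step`). The powers stay above $\sigma_{lb}^2$, so $\|e_t\|^2\le\mu\bar
J/2$ almost surely. The descent inequality and $J^\star\le\bar J/4$ then give
$J(K_{t+1})\le(1-\mu\eta)\bar J+\tfrac14\mu\eta\bar J+\tfrac14\mu\eta\bar J\le\bar J$.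

On this invariant set the expected gap contracts by $1-\mu\eta=\gamma^2$, since the cross term
vanishes by independence, and each step adds $L\eta^2G^2\sigma_N^2/\sigma_t^2$. Unrolling
(`pagd_convergence`) leaves $\sum_t\gamma^{2(T-t-1)}/\sigma_t^2$, which `sum_pow_div_ctgPowerSq`
evaluates for the CtG powers. -/

namespace LQRPower

open Matrix Filter Topology

/-! ### Quadratic forms and trace inequalities -/

section QuadraticForms

theorem transpose_eq_of_posSemidef {ι : Type*} {S : Matrix ι ι ℝ} (hS : S.PosSemidef) : Sᵀ = S := by
  simpa [IsHermitian, conjTranspose_eq_transpose_of_trivial] using hS.isHermitian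

variable {ι κ : Type*} [Fintype ι] [Fintype κ]

theorem quadForm_nonneg {S : Matrix ι ι ℝ} (hS : S.PosSemidef) (x : ι → ℝ) :
    0 ≤ x ⬝ᵥ S *ᵥ x := by
  simpa using hS.dotProduct_mulVec_nonneg x

theorem posSemidef_of_quadForm_nonneg {S : Matrix ι ι ℝ} (hS : Sᵀ = S)
    (h : ∀ x, 0 ≤ x ⬝ᵥ S *ᵥ x) : S.PosSemidef :=
  .of_dotProduct_mulVec_nonneg (by rw [IsHermitian, conjTranspose_eq_transpose_of_trivial, hS])
    (by simpa using h)

theorem bilinForm_comm {S : Matrix ι ι ℝ} (hS : Sᵀ = S) (x y : ι → ℝ) :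
    x ⬝ᵥ S *ᵥ y = y ⬝ᵥ S *ᵥ x := by
  rw [dotProduct_mulVec, ← mulVec_transpose, hS, dotProduct_comm]

/-- `(A x)ᵀ S (B y) = xᵀ (Aᵀ S B) y`. -/
theorem dotProduct_congruence {ι' κ' : Type*} [Fintype ι'] [Fintype κ'] (S : Matrix κ κ' ℝ)
    (A : Matrix κ ι ℝ) (B : Matrix κ' ι' ℝ) (x : ι → ℝ) (y : ι' → ℝ) :
    x ⬝ᵥ (Aᵀ * S * B) *ᵥ y = (A *ᵥ x) ⬝ᵥ S *ᵥ (B *ᵥ y) := by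
  rw [← mulVec_mulVec, ← mulVec_mulVec, dotProduct_mulVec, vecMul_transpose]

theorem dotProduct_transpose_mul_mulVec (A B : Matrix κ ι ℝ) (x y : ι → ℝ) :
    x ⬝ᵥ (Aᵀ * B) *ᵥ y = (A *ᵥ x) ⬝ᵥ (B *ᵥ y) := by
  rw [← mulVec_mulVec, dotProduct_mulVec, vecMul_transpose]

theorem quadForm_add {S : Matrix ι ι ℝ} (hS : Sᵀ = S) (x y : ι → ℝ) :
    (x + y) ⬝ᵥ S *ᵥ (x + y) = x ⬝ᵥ S *ᵥ x + 2 * (x ⬝ᵥ S *ᵥ y) + y ⬝ᵥ S *ᵥ y := by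
  rw [mulVec_add, add_dotProduct, dotProduct_add, dotProduct_add, bilinForm_comm hS y x]
  ring

theorem quadForm_smul (S : Matrix ι ι ℝ) (c : ℝ) (x : ι → ℝ) :
    (c • x) ⬝ᵥ S *ᵥ (c • x) = c ^ 2 * (x ⬝ᵥ S *ᵥ x) := by
  simp [mulVec_smul]
  ring

/-- Young's inequality: the form is nonnegative at $ax\pm y$; divide by $a$. The free weight is
tuned at each use. -/
theorem two_mul_bilinForm_le {S : Matrix ι ι ℝ} (hS : S.PosSemidef) {a : ℝ} (ha : 0 < a)
    (x y : ι → ℝ) :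
    2 * |x ⬝ᵥ S *ᵥ y| ≤ a * (x ⬝ᵥ S *ᵥ x) + a⁻¹ * (y ⬝ᵥ S *ᵥ y) := by
  have hT := transpose_eq_of_posSemidef hS
  have key : ∀ c : ℝ, c ^ 2 = 1 →
      2 * c * (x ⬝ᵥ S *ᵥ y) ≤ a * (x ⬝ᵥ S *ᵥ x) + a⁻¹ * (y ⬝ᵥ S *ᵥ y) := by
    intro c hc
    have h := quadForm_nonneg hS (a • x + (-c) • y)
    rw [quadForm_add hT, quadForm_smul, quadForm_smul, mulVec_smul, smul_dotProduct,
      dotProduct_smul, smul_eq_mul, smul_eq_mul, neg_sq, hc] at h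
    have h2 := mul_nonneg (inv_nonneg.2 ha.le) h
    have : a⁻¹ * a = 1 := inv_mul_cancel₀ ha.ne'
    have e : a⁻¹ * (a ^ 2 * x ⬝ᵥ S *ᵥ x + 2 * (a * (-c * x ⬝ᵥ S *ᵥ y)) + 1 * y ⬝ᵥ S *ᵥ y)
        = (a⁻¹ * a) * a * (x ⬝ᵥ S *ᵥ x) - 2 * c * (a⁻¹ * a) * (x ⬝ᵥ S *ᵥ y)
          + a⁻¹ * (y ⬝ᵥ S *ᵥ y) := by ring
    rw [e, this] at h2
    linarith
  have h1 := key 1 (by norm_num)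
  have h2 := key (-1) (by norm_num)
  rcases abs_cases (x ⬝ᵥ S *ᵥ y) with h | h <;> rw [h.1] <;> linarith

theorem bilinForm_sq_le {S : Matrix ι ι ℝ} (hS : S.PosSemidef) (x y : ι → ℝ) :
    (x ⬝ᵥ S *ᵥ y) ^ 2 ≤ (x ⬝ᵥ S *ᵥ x) * (y ⬝ᵥ S *ᵥ y) := by
  have hT := transpose_eq_of_posSemidef hS
  have h : ∀ t : ℝ, 0 ≤ (x ⬝ᵥ S *ᵥ x) * (t * t) + 2 * (x ⬝ᵥ S *ᵥ y) * t + y ⬝ᵥ S *ᵥ y := by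
    intro t
    have h := quadForm_nonneg hS (t • x + y)
    rw [quadForm_add hT, quadForm_smul, smul_dotProduct, smul_eq_mul] at h
    linarith
  have := discrim_le_zero h
  rw [discrim] at this
  linarith

theorem dotProduct_sq_le (x y : ι → ℝ) : (x ⬝ᵥ y) ^ 2 ≤ (x ⬝ᵥ x) * (y ⬝ᵥ y) := by
  simpa [dotProduct, sq] using Finset.sum_mul_sq_le_sq_mul_sq Finset.univ x y

theorem dotProduct_self_nonneg' (x : ι → ℝ) : 0 ≤ x ⬝ᵥ x :=
  Finset.sum_nonneg fun i _ => mul_self_nonneg (x i)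

open scoped MatrixOrder in
theorem exists_transpose_mul_self {S : Matrix ι ι ℝ} (hS : S.PosSemidef) :
    ∃ C : Matrix ι ι ℝ, S = Cᵀ * C := by
  classical
  obtain ⟨C, hC⟩ := CStarAlgebra.nonneg_iff_eq_star_mul_self.mp hS.nonneg
  exact ⟨C, by simpa [star_eq_conjTranspose] using hC⟩

/-- With a positive semidefinite matrix factored as $C^\top C$, every trace comparison below reduces
to quadratic forms at the rows of $C$, so $X$ need not be symmetric. -/
theorem trace_mul_transpose_mul_self (X : Matrix ι ι ℝ) (C : Matrix κ ι ℝ) :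
    (X * (Cᵀ * C)).trace = ∑ i, C i ⬝ᵥ X *ᵥ C i := by
  rw [← Matrix.mul_assoc, trace_mul_comm, ← Matrix.mul_assoc]
  simp only [trace, diag, mul_apply, dotProduct, mulVec, transpose_apply, Finset.sum_mul,
    Finset.mul_sum]
  refine Finset.sum_congr rfl fun i _ => ?_
  rw [Finset.sum_comm]
  exact Finset.sum_congr rfl fun j _ => Finset.sum_congr rfl fun k _ => by ring

theorem trace_mul_le_trace_mul {X Y S : Matrix ι ι ℝ} (hS : S.PosSemidef)
    (h : ∀ x, x ⬝ᵥ X *ᵥ x ≤ x ⬝ᵥ Y *ᵥ x) : (X * S).trace ≤ (Y * S).trace := by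
  obtain ⟨C, rfl⟩ := exists_transpose_mul_self hS
  rw [trace_mul_transpose_mul_self, trace_mul_transpose_mul_self]
  exact Finset.sum_le_sum fun i _ => h _

theorem trace_mul_le_of_quadForm_le [DecidableEq ι] {X S : Matrix ι ι ℝ} {c : ℝ}
    (hS : S.PosSemidef) (h : ∀ x, x ⬝ᵥ X *ᵥ x ≤ c * (x ⬝ᵥ x)) : (X * S).trace ≤ c * S.trace := by
  have := trace_mul_le_trace_mul (X := X) (Y := c • (1 : Matrix ι ι ℝ)) hS
    (fun x => by simpa [smul_mulVec] using h x)
  simpa using this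

theorem le_trace_mul_of_le_quadForm [DecidableEq ι] {X S : Matrix ι ι ℝ} {c : ℝ}
    (hS : S.PosSemidef) (h : ∀ x, c * (x ⬝ᵥ x) ≤ x ⬝ᵥ X *ᵥ x) : c * S.trace ≤ (X * S).trace := by
  have := trace_mul_le_trace_mul (X := c • (1 : Matrix ι ι ℝ)) (Y := X) hS
    (fun x => by simpa [smul_mulVec] using h x)
  simpa using this

theorem quadForm_le_trace_mul {S : Matrix ι ι ℝ} (hS : S.PosSemidef) (x : ι → ℝ) :
    x ⬝ᵥ S *ᵥ x ≤ S.trace * (x ⬝ᵥ x) := by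
  classical
  obtain ⟨C, rfl⟩ := exists_transpose_mul_self hS
  have h1 : (Cᵀ * C).trace = ∑ i, C i ⬝ᵥ C i := by
    simpa using trace_mul_transpose_mul_self (1 : Matrix ι ι ℝ) C
  have h2 : x ⬝ᵥ (Cᵀ * C) *ᵥ x = ∑ i, (C i ⬝ᵥ x) ^ 2 := by
    have := dotProduct_congruence (1 : Matrix ι ι ℝ) C C x x
    rw [Matrix.mul_one, one_mulVec] at this
    rw [this]
    simp [dotProduct, mulVec, sq]
  rw [h1, h2, Finset.sum_mul]
  exact Finset.sum_le_sum fun i _ => dotProduct_sq_le _ _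

theorem transpose_mul_self_posSemidef (C : Matrix κ ι ℝ) : (Cᵀ * C).PosSemidef := by
  simpa using posSemidef_conjTranspose_mul_self C

/-- Cauchy–Schwarz for the form $S$ at $x$ and $Sx$ gives $(x^\top S^2x)^2\le(x^\top Sx)\,c\,(x^\top
S^2x)$; divide unless $Sx=0$. -/
theorem quadForm_mul_self_le {S : Matrix ι ι ℝ} {c : ℝ} (hS : S.PosSemidef)
    (h : ∀ x, x ⬝ᵥ S *ᵥ x ≤ c * (x ⬝ᵥ x)) (x : ι → ℝ) :
    x ⬝ᵥ (S * S) *ᵥ x ≤ c * (x ⬝ᵥ S *ᵥ x) := by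
  have hT := transpose_eq_of_posSemidef hS
  have e : x ⬝ᵥ (S * S) *ᵥ x = x ⬝ᵥ S *ᵥ (S *ᵥ x) := by rw [mulVec_mulVec]
  have e' : x ⬝ᵥ (S * S) *ᵥ x = (S *ᵥ x) ⬝ᵥ (S *ᵥ x) := by rw [e, bilinForm_comm hT]
  have h1 := bilinForm_sq_le hS x (S *ᵥ x)
  have h2 := h (S *ᵥ x)
  rw [← e] at h1
  rw [← e'] at h2
  have h0 := quadForm_nonneg hS x
  have h3 : 0 ≤ x ⬝ᵥ (S * S) *ᵥ x := by rw [e']; exact dotProduct_self_nonneg' _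
  rcases h3.eq_or_lt with h4 | h4
  · have hx : S *ᵥ x = 0 := by
      rw [e'] at h4
      exact dotProduct_self_eq_zero.1 h4.symm
    rw [← h4, hx]
    simp
  · have := mul_le_mul_of_nonneg_left h2 h0
    nlinarith

theorem le_quadForm_mul_self {S : Matrix ι ι ℝ} {c : ℝ} (hc : 0 ≤ c) (hS : Sᵀ = S)
    (h : ∀ x, c * (x ⬝ᵥ x) ≤ x ⬝ᵥ S *ᵥ x) (x : ι → ℝ) :
    c ^ 2 * (x ⬝ᵥ x) ≤ x ⬝ᵥ (S * S) *ᵥ x := by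
  have e' : x ⬝ᵥ (S * S) *ᵥ x = (S *ᵥ x) ⬝ᵥ (S *ᵥ x) := by
    rw [← mulVec_mulVec, bilinForm_comm hS]
  have h1 := dotProduct_sq_le x (S *ᵥ x)
  have h2 := h x
  have h0 := dotProduct_self_nonneg' x
  rw [e']
  rcases h0.eq_or_lt with h4 | h4
  · rw [← h4, mul_zero]
    exact dotProduct_self_nonneg' _
  · have h5 := pow_le_pow_left₀ (mul_nonneg hc h0) h2 2
    have h6 : (x ⬝ᵥ x) * (c ^ 2 * (x ⬝ᵥ x)) ≤ (x ⬝ᵥ x) * (S *ᵥ x ⬝ᵥ S *ᵥ x) := by nlinarith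
    exact le_of_mul_le_mul_left h6 h4

end QuadraticForms

/-! ### Schur stability and the discrete Lyapunov equation -/

section Stability

variable {n : ℕ}

open scoped Matrix.Norms.L2Operator in
-- Gelfand's formula over $\mathbb C$: eventually $\|a^k\|\le r^k$ for some $r<1$ above the spectral
-- radius. Real parts return to $M$.
theorem IsSchurStable.tendsto_pow {M : Matrix (Fin n) (Fin n) ℝ} (hM : IsSchurStable M) :
    Tendsto (fun k : ℕ => M ^ k) atTop (𝓝 0) := by
  rcases n.eq_zero_or_pos with rfl | hn
  · have : (fun k : ℕ => M ^ k) = fun _ => 0 := by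
      funext k; ext i; exact i.elim0
    rw [this]
    exact tendsto_const_nhds
  have : Nonempty (Fin n) := ⟨⟨0, hn⟩⟩
  set a : Matrix (Fin n) (Fin n) ℂ := M.map ((↑) : ℝ → ℂ) with ha
  have hlt : spectralRadius ℂ a < ((1 : NNReal) : ENNReal) :=
    spectrum.spectralRadius_lt_of_forall_lt a fun z hz => by
      have := hM z hz
      exact_mod_cast this
  obtain ⟨r, hr1, hr2⟩ := exists_between hlt
  have hev := (spectrum.pow_nnnorm_pow_one_div_tendsto_nhds_spectralRadius a).eventually_lt_const
    hr1
  have hrtop : r ≠ ⊤ := ne_top_of_lt hr2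
  lift r to NNReal using hrtop
  have hr : r < 1 := by exact_mod_cast hr2
  have hbound : ∀ᶠ k : ℕ in atTop, ‖a ^ k‖ ≤ (r : ℝ) ^ k := by
    filter_upwards [hev, eventually_gt_atTop 0] with k hk hk0
    have h1 := ENNReal.rpow_le_rpow hk.le (Nat.cast_nonneg k : (0 : ℝ) ≤ k)
    rw [← ENNReal.rpow_mul, one_div, inv_mul_cancel₀ (by exact_mod_cast hk0.ne'),
      ENNReal.rpow_one, ENNReal.rpow_natCast] at h1
    exact_mod_cast h1
  have hca : Tendsto (fun k : ℕ => a ^ k) atTop (𝓝 0) :=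
    squeeze_zero_norm' hbound (tendsto_pow_atTop_nhds_zero_of_lt_one r.2 (by exact_mod_cast hr))
  have hre : Continuous fun X : Matrix (Fin n) (Fin n) ℂ => X.map Complex.re :=
    continuous_id.matrix_map Complex.continuous_re
  have h2 := (hre.tendsto 0).comp hca
  have e : ((fun X : Matrix (Fin n) (Fin n) ℂ => X.map Complex.re) ∘ fun k : ℕ => a ^ k)
      = fun k : ℕ => M ^ k := by
    funext k
    have : a ^ k = (M ^ k).map ((↑) : ℝ → ℂ) :=
      (Matrix.map_pow (f := Complex.ofRealHom) M k).symm
    ext i j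
    simp [this]
  rw [e] at h2
  have e0 : (0 : Matrix (Fin n) (Fin n) ℂ).map Complex.re = 0 := by ext; simp
  simpa [e0] using h2

open scoped Matrix.Norms.L2Operator in
theorem isSchurStable_of_tendsto_pow {M : Matrix (Fin n) (Fin n) ℝ}
    (hM : Tendsto (fun k : ℕ => M ^ k) atTop (𝓝 0)) : IsSchurStable M := by
  intro z hz
  rcases n.eq_zero_or_pos with rfl | hn
  · rw [spectrum.of_subsingleton] at hz
    exact hz.elim
  have : Nonempty (Fin n) := ⟨⟨0, hn⟩⟩
  set a : Matrix (Fin n) (Fin n) ℂ := M.map ((↑) : ℝ → ℂ) with ha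
  have hco : Continuous fun X : Matrix (Fin n) (Fin n) ℝ => X.map ((↑) : ℝ → ℂ) :=
    continuous_id.matrix_map Complex.continuous_ofReal
  have h2 := (hco.tendsto 0).comp hM
  have e : ((fun X : Matrix (Fin n) (Fin n) ℝ => X.map ((↑) : ℝ → ℂ)) ∘ fun k : ℕ => M ^ k)
      = fun k : ℕ => a ^ k := by
    funext k
    exact Matrix.map_pow (f := Complex.ofRealHom) M k
  rw [e] at h2
  have e0 : (0 : Matrix (Fin n) (Fin n) ℝ).map ((↑) : ℝ → ℂ) = 0 := by ext; simp
  rw [e0] at h2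
  have h3 := h2.norm
  rw [norm_zero] at h3
  by_contra! hz1
  have h4 : ∀ k : ℕ, 1 ≤ ‖a ^ k‖ := fun k =>
    calc 1 ≤ ‖z‖ ^ k := one_le_pow₀ hz1
      _ = ‖z ^ k‖ := (norm_pow _ _).symm
      _ ≤ ‖a ^ k‖ := spectrum.norm_le_norm_of_mem (spectrum.pow_mem_pow a k hz)
  exact absurd (ge_of_tendsto' h3 h4) (by norm_num)

theorem tendsto_pow_transpose {M : Matrix (Fin n) (Fin n) ℝ}
    (hM : Tendsto (fun k : ℕ => M ^ k) atTop (𝓝 0)) :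
    Tendsto (fun k : ℕ => Mᵀ ^ k) atTop (𝓝 0) := by
  have h := ((continuous_id.matrix_transpose (X := Matrix (Fin n) (Fin n) ℝ)).tendsto 0).comp hM
  simpa [Function.comp_def, transpose_pow] using h

theorem tendsto_pow_congruence {M : Matrix (Fin n) (Fin n) ℝ}
    (hM : Tendsto (fun k : ℕ => M ^ k) atTop (𝓝 0)) (Z : Matrix (Fin n) (Fin n) ℝ) :
    Tendsto (fun k : ℕ => M ^ k * Z * Mᵀ ^ k) atTop (𝓝 0) := by
  simpa using (hM.mul_const Z).mul (tendsto_pow_transpose hM)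

theorem eq_zero_of_eq_congruence {M Z : Matrix (Fin n) (Fin n) ℝ}
    (hM : Tendsto (fun k : ℕ => M ^ k) atTop (𝓝 0)) (hZ : Z = M * Z * Mᵀ) : Z = 0 := by
  have h : ∀ k : ℕ, M ^ k * Z * Mᵀ ^ k = Z := by
    intro k
    induction k with
    | zero => simp
    | succ k ih =>
      calc M ^ (k + 1) * Z * Mᵀ ^ (k + 1) = M ^ k * (M * Z * Mᵀ) * Mᵀ ^ k := by
            rw [pow_succ, pow_succ']
            simp only [Matrix.mul_assoc]
        _ = Z := by rw [← hZ, ih]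
  have h2 := tendsto_pow_congruence hM Z
  simp only [h] at h2
  exact tendsto_nhds_unique tendsto_const_nhds h2

/-- Discrete Lyapunov comparison: `Z - M Z Mᵀ ⪰ 0` forces `Z ⪰ 0` when `M ^ k → 0`. -/
theorem quadForm_nonneg_of_congruence_le {M Z : Matrix (Fin n) (Fin n) ℝ}
    (hM : Tendsto (fun k : ℕ => M ^ k) atTop (𝓝 0))
    (h : ∀ x, x ⬝ᵥ (M * Z * Mᵀ) *ᵥ x ≤ x ⬝ᵥ Z *ᵥ x) (x : Fin n → ℝ) :
    0 ≤ x ⬝ᵥ Z *ᵥ x := by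
  have h1 : ∀ k : ℕ, x ⬝ᵥ (M ^ k * Z * Mᵀ ^ k) *ᵥ x ≤ x ⬝ᵥ Z *ᵥ x := by
    intro k
    induction k with
    | zero => simp
    | succ k ih =>
      refine le_trans ?_ ih
      have e : M ^ (k + 1) * Z * Mᵀ ^ (k + 1) = (Mᵀ ^ k)ᵀ * (M * Z * Mᵀ) * Mᵀ ^ k := by
        rw [pow_succ, pow_succ', transpose_pow, transpose_transpose]
        simp only [Matrix.mul_assoc]
      have e' : M ^ k * Z * Mᵀ ^ k = (Mᵀ ^ k)ᵀ * Z * Mᵀ ^ k := by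
        rw [transpose_pow, transpose_transpose]
      rw [e, e', dotProduct_congruence, dotProduct_congruence]
      exact h _
  have hc : Continuous fun X : Matrix (Fin n) (Fin n) ℝ => x ⬝ᵥ X *ᵥ x :=
    continuous_const.dotProduct (continuous_id.matrix_mulVec continuous_const)
  have h2 := (hc.tendsto 0).comp (tendsto_pow_congruence hM Z)
  simp only [zero_mulVec, dotProduct_zero] at h2
  exact le_of_tendsto h2 (Eventually.of_forall h1)

/-- The discrete Lyapunov equation has a positive semidefinite solution when `M ^ k → 0`. -/
theorem exists_lyapunov {M W : Matrix (Fin n) (Fin n) ℝ}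
    (hM : Tendsto (fun k : ℕ => M ^ k) atTop (𝓝 0)) (hW : W.PosSemidef) :
    ∃ S : Matrix (Fin n) (Fin n) ℝ, S.PosSemidef ∧ S = W + M * S * Mᵀ := by
  let F : Matrix (Fin n) (Fin n) ℝ →ₗ[ℝ] Matrix (Fin n) (Fin n) ℝ :=
    { toFun := fun S => S - M * S * Mᵀ
      map_add' := fun S T => by simp only [Matrix.mul_add, Matrix.add_mul]; abel
      map_smul' := fun c S => by simp [smul_sub] }
  -- In finite dimension, injectivity of $S\mapsto S-MSM^\top$ gives existence. It also gives
  -- symmetry, since $S^\top$ solves the same equation.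
  have hinj : Function.Injective F := by
    rw [← LinearMap.ker_eq_bot, LinearMap.ker_eq_bot']
    intro S hS
    exact eq_zero_of_eq_congruence hM (sub_eq_zero.1 hS)
  obtain ⟨S, hS⟩ := LinearMap.injective_iff_surjective.1 hinj W
  have hS' : S - M * S * Mᵀ = W := hS
  have hWT := transpose_eq_of_posSemidef hW
  have hT : Sᵀ = S := by
    apply hinj
    change Sᵀ - M * Sᵀ * Mᵀ = S - M * S * Mᵀ
    rw [hS', ← hWT, ← hS']
    simp [Matrix.mul_assoc]
  refine ⟨S, posSemidef_of_quadForm_nonneg hT ?_, by rw [← hS']; abel⟩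
  refine quadForm_nonneg_of_congruence_le hM fun x => ?_
  have := quadForm_nonneg hW x
  rw [← hS', sub_mulVec, dotProduct_sub] at this
  linarith

/-- A quadratic Lyapunov function contracted by `Mᵀ` certifies `M ^ k → 0`. -/
theorem tendsto_pow_of_contraction {M S : Matrix (Fin n) (Fin n) ℝ} {c q : ℝ} (hc : 0 < c)
    (hS : ∀ x, c * (x ⬝ᵥ x) ≤ x ⬝ᵥ S *ᵥ x) (hq0 : 0 ≤ q) (hq : q < 1)
    (h : ∀ x, x ⬝ᵥ (M * S * Mᵀ) *ᵥ x ≤ q * (x ⬝ᵥ S *ᵥ x)) :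
    Tendsto (fun k : ℕ => M ^ k) atTop (𝓝 0) := by
  -- The energy $x^\top Sx$ decays like $q^k$ along powers of $M^\top$ and dominates every squared
  -- coordinate up to $c^{-1}$.
  have h1 : ∀ (k : ℕ) (x : Fin n → ℝ),
      (Mᵀ ^ k *ᵥ x) ⬝ᵥ S *ᵥ (Mᵀ ^ k *ᵥ x) ≤ q ^ k * (x ⬝ᵥ S *ᵥ x) := by
    intro k
    induction k with
    | zero => simp
    | succ k ih =>
      intro x
      have h2 := h (Mᵀ ^ k *ᵥ x)
      have e : M * S * Mᵀ = Mᵀᵀ * S * Mᵀ := by rw [transpose_transpose]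
      rw [e, dotProduct_congruence, mulVec_mulVec, ← pow_succ'] at h2
      calc _ ≤ _ := h2
        _ ≤ q * (q ^ k * (x ⬝ᵥ S *ᵥ x)) := mul_le_mul_of_nonneg_left (ih x) hq0
        _ = _ := by ring
  have h3 : ∀ x, Tendsto (fun k : ℕ => Mᵀ ^ k *ᵥ x) atTop (𝓝 0) := by
    intro x
    rw [tendsto_pi_nhds]
    intro i
    have h4 : ∀ k : ℕ, (Mᵀ ^ k *ᵥ x) i ^ 2 ≤ q ^ k * (c⁻¹ * (x ⬝ᵥ S *ᵥ x)) := by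
      intro k
      have h5 : (Mᵀ ^ k *ᵥ x) i ^ 2 ≤ (Mᵀ ^ k *ᵥ x) ⬝ᵥ (Mᵀ ^ k *ᵥ x) := by
        rw [sq]
        exact Finset.single_le_sum (f := fun i => (Mᵀ ^ k *ᵥ x) i * (Mᵀ ^ k *ᵥ x) i)
          (fun j _ => mul_self_nonneg _) (Finset.mem_univ i)
      have h6 := (hS (Mᵀ ^ k *ᵥ x)).trans (h1 k x)
      rw [mul_left_comm, ← div_eq_inv_mul, le_div_iff₀ hc]
      nlinarith
    have h7 : Tendsto (fun k : ℕ => q ^ k * (c⁻¹ * (x ⬝ᵥ S *ᵥ x))) atTop (𝓝 0) := by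
      simpa using (tendsto_pow_atTop_nhds_zero_of_lt_one hq0 hq).mul_const (c⁻¹ * (x ⬝ᵥ S *ᵥ x))
    have h8 := squeeze_zero (fun k => sq_nonneg ((Mᵀ ^ k *ᵥ x) i)) h4 h7
    have h9 := h8.sqrt
    rw [Real.sqrt_zero] at h9
    simp only [Real.sqrt_sq_eq_abs] at h9
    simpa using (tendsto_zero_iff_abs_tendsto_zero _).2 h9
  have h10 : Tendsto (fun k : ℕ => Mᵀ ^ k) atTop (𝓝 0) := by
    refine tendsto_pi_nhds.2 fun i => tendsto_pi_nhds.2 fun j => ?_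
    have := (tendsto_pi_nhds.1 (h3 (Pi.single j 1))) i
    simpa using this
  simpa using tendsto_pow_transpose h10

end Stability

end LQRPower

/-! ### Policy gradient identities and bounds from the cost -/

namespace LQRPower

open Matrix Filter Topology

section Gains

variable {m n : ℕ}

theorem Gain.toMat_add (K K' : Gain m n) : (K + K').toMat = K.toMat + K'.toMat := rfl

/-- An `m × n` matrix, read as a gain. -/
def Gain.ofMat (X : Matrix (Fin m) (Fin n) ℝ) : Gain m n := WithLp.toLp 2 fun p => X p.1 p.2

theorem Gain.toMat_ofMat (X : Matrix (Fin m) (Fin n) ℝ) : (Gain.ofMat X).toMat = X := rfl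

theorem Gain.inner_eq_trace (K K' : Gain m n) :
    inner ℝ K K' = (K.toMatᵀ * K'.toMat).trace := by
  simp only [PiLp.inner_apply, Fintype.sum_prod_type, trace, diag, mul_apply, Gain.toMat,
    transpose_apply, of_apply]
  rw [Finset.sum_comm]
  simp [mul_comm]

theorem Gain.norm_sq_eq_trace (K : Gain m n) : ‖K‖ ^ 2 = (K.toMatᵀ * K.toMat).trace := by
  rw [← Gain.inner_eq_trace, real_inner_self_eq_norm_sq]

end Gains

/-- Split $X=(X+\delta S)-\delta S$ into positive semidefinite pieces. Since $X+\delta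
S\preceq2\delta S$, they contribute $2\delta$ and $\delta$, whence the 3. -/
theorem abs_trace_mul_le {ι : Type*} [Fintype ι] {X U V S : Matrix ι ι ℝ} {δ : ℝ} (hδ : 0 ≤ δ)
    (hS : S.PosSemidef) (hX : Xᵀ = X) (hV : V.PosSemidef)
    (hXS : ∀ x, |x ⬝ᵥ X *ᵥ x| ≤ δ * (x ⬝ᵥ S *ᵥ x))
    (hUV : ∀ x, |x ⬝ᵥ U *ᵥ x| ≤ x ⬝ᵥ V *ᵥ x) :
    |(U * X).trace| ≤ 3 * δ * (V * S).trace := by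
  have hY : (X + δ • S).PosSemidef := by
    refine posSemidef_of_quadForm_nonneg ?_ fun x => ?_
    · rw [transpose_add, transpose_smul, hX, transpose_eq_of_posSemidef hS]
    · rw [add_mulVec, dotProduct_add, smul_mulVec, dotProduct_smul, smul_eq_mul]
      linarith [(abs_le.1 (hXS x)).1]
  have key : ∀ T : Matrix ι ι ℝ, T.PosSemidef → |(U * T).trace| ≤ (V * T).trace := by
    intro T hT
    rw [abs_le]
    constructor
    · have := trace_mul_le_trace_mul (X := -U) (Y := V) hT fun x => by
        rw [neg_mulVec, dotProduct_neg]
        linarith [(abs_le.1 (hUV x)).1]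
      rw [Matrix.neg_mul, trace_neg] at this
      linarith
    · exact trace_mul_le_trace_mul hT fun x => (abs_le.1 (hUV x)).2
  have h1 := key _ hY
  have h2 := key _ hS
  have h3 : (V * (X + δ • S)).trace ≤ 2 * δ * (V * S).trace := by
    rw [trace_mul_comm V, trace_mul_comm V, ← smul_eq_mul (2 * δ), ← trace_smul, ← Matrix.smul_mul]
    refine trace_mul_le_trace_mul hV fun x => ?_
    rw [add_mulVec, dotProduct_add, smul_mulVec, dotProduct_smul, smul_mulVec, dotProduct_smul,
      smul_eq_mul, smul_eq_mul]
    linarith [(abs_le.1 (hXS x)).2]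
  have h4 : (U * X).trace = (U * (X + δ • S)).trace - δ * (U * S).trace := by
    rw [Matrix.mul_add, trace_add, Matrix.mul_smul, trace_smul, smul_eq_mul]
    ring
  have h5 : |δ * (U * S).trace| ≤ δ * (V * S).trace := by
    rw [abs_mul, abs_of_nonneg hδ]
    exact mul_le_mul_of_nonneg_left h2 hδ
  rw [h4]
  calc _ ≤ |(U * (X + δ • S)).trace| + |δ * (U * S).trace| := abs_sub _ _
    _ ≤ _ := by linarith

namespace LQR

variable {n m : ℕ}

/-- Quantitative bounds on the data of an LQR problem. -/
structure Bounded (S : LQR n m) (β₀ σw ψ : ℝ) : Prop where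
  pos : 0 < β₀
  le_one : β₀ ≤ 1
  noise_pos : 0 < σw
  one_le : 1 ≤ ψ
  psdQ : S.Q.PosSemidef
  psdR : S.R.PosSemidef
  psdW : S.W.PosSemidef
  le_Q : ∀ x, β₀ * (x ⬝ᵥ x) ≤ x ⬝ᵥ S.Q *ᵥ x
  le_R : ∀ x, β₀ * (x ⬝ᵥ x) ≤ x ⬝ᵥ S.R *ᵥ x
  R_le : ∀ x, x ⬝ᵥ S.R *ᵥ x ≤ x ⬝ᵥ x
  le_W : ∀ x, σw ^ 2 * (x ⬝ᵥ x) ≤ x ⬝ᵥ S.W *ᵥ x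
  B_le : ∀ x, (S.B *ᵥ x) ⬝ᵥ (S.B *ᵥ x) ≤ ψ ^ 2 * (x ⬝ᵥ x)
  Bt_le : ∀ x, (S.Bᵀ *ᵥ x) ⬝ᵥ (S.Bᵀ *ᵥ x) ≤ ψ ^ 2 * (x ⬝ᵥ x)

/-- Stage cost matrix `Q + Kᵀ R K` of the policy `u = K x`. -/
def stageCost (S : LQR n m) (K : Gain m n) : Matrix (Fin n) (Fin n) ℝ :=
  S.Q + K.toMatᵀ * S.R * K.toMat

/-- Value matrix of the policy `u = K x`. -/
noncomputable def valueMat (S : LQR n m) (K : Gain m n) : Matrix (Fin n) (Fin n) ℝ :=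
  lyapunovSolution (S.closedLoop K)ᵀ (S.stageCost K)

/-- The factor `E_K` of the policy gradient `2 E_K Σ_K`. -/
noncomputable def gradFactor (S : LQR n m) (K : Gain m n) : Matrix (Fin m) (Fin n) ℝ :=
  S.R * K.toMat + S.Bᵀ * S.valueMat K * S.closedLoop K

/-- The policy gradient `2 E_K Σ_K`. -/
noncomputable def policyGrad (S : LQR n m) (K : Gain m n) : Gain m n :=
  Gain.ofMat ((2 : ℝ) • (S.gradFactor K * S.stateCov K))

end LQR

/-- The lower bound on $W$ makes the solution positive definite, so the default value 0 of
`lyapunovSolution` does not arise. -/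
theorem lyapunovSolution_spec {n : ℕ} {M W : Matrix (Fin n) (Fin n) ℝ} {c : ℝ}
    (hM : Tendsto (fun k : ℕ => M ^ k) atTop (𝓝 0)) (hW : W.PosSemidef) (hc : 0 < c)
    (hWc : ∀ x, c * (x ⬝ᵥ x) ≤ x ⬝ᵥ W *ᵥ x) :
    (lyapunovSolution M W).PosSemidef ∧
      lyapunovSolution M W = W + M * lyapunovSolution M W * Mᵀ := by
  have hex : ∃ S : Matrix (Fin n) (Fin n) ℝ, S.PosDef ∧ S = W + M * S * Mᵀ := by
    obtain ⟨S, hS, hSW⟩ := exists_lyapunov hM hW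
    have hWd : W.PosDef := by
      refine .of_dotProduct_mulVec_pos hW.1 fun x hx => ?_
      have h1 : 0 < x ⬝ᵥ x := lt_of_le_of_ne (dotProduct_self_nonneg' x) fun h =>
        hx (dotProduct_self_eq_zero.1 h.symm)
      simpa using (mul_pos hc h1).trans_le (hWc x)
    have h2 : (M * S * Mᵀ).PosSemidef := by simpa using hS.mul_mul_conjTranspose_same M
    exact ⟨S, by rw [hSW]; exact hWd.add_posSemidef h2, hSW⟩
  rw [lyapunovSolution, dif_pos hex]
  exact ⟨hex.choose_spec.1.posSemidef, hex.choose_spec.2⟩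

namespace LQR

variable {n m : ℕ} {S : LQR n m} {β₀ σw ψ : ℝ} {K K' : Gain m n}

theorem Bounded.psd_stageCost (hS : S.Bounded β₀ σw ψ) (K : Gain m n) :
    (S.stageCost K).PosSemidef := by
  refine hS.psdQ.add ?_
  simpa using hS.psdR.conjTranspose_mul_mul_same K.toMat

theorem quadForm_stageCost (x : Fin n → ℝ) :
    x ⬝ᵥ S.stageCost K *ᵥ x = x ⬝ᵥ S.Q *ᵥ x + (K.toMat *ᵥ x) ⬝ᵥ S.R *ᵥ (K.toMat *ᵥ x) := by
  rw [stageCost, add_mulVec, dotProduct_add, dotProduct_congruence]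

theorem Bounded.le_stageCost (hS : S.Bounded β₀ σw ψ) (x : Fin n → ℝ) :
    β₀ * (x ⬝ᵥ x) ≤ x ⬝ᵥ S.stageCost K *ᵥ x := by
  rw [quadForm_stageCost]
  linarith [hS.le_Q x, quadForm_nonneg hS.psdR (K.toMat *ᵥ x)]

theorem Bounded.stateCov_spec (hS : S.Bounded β₀ σw ψ) (hK : S.Stabilizing K) :
    (S.stateCov K).PosSemidef ∧
      S.stateCov K = S.W + S.closedLoop K * S.stateCov K * (S.closedLoop K)ᵀ :=
  lyapunovSolution_spec (IsSchurStable.tendsto_pow hK) hS.psdW (pow_pos hS.noise_pos 2) hS.le_W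

theorem Bounded.valueMat_spec (hS : S.Bounded β₀ σw ψ) (hK : S.Stabilizing K) :
    (S.valueMat K).PosSemidef ∧
      S.valueMat K =
        S.stageCost K + (S.closedLoop K)ᵀ * S.valueMat K * S.closedLoop K := by
  have h := lyapunovSolution_spec (tendsto_pow_transpose (IsSchurStable.tendsto_pow hK))
    (hS.psd_stageCost K) hS.pos hS.le_stageCost
  rwa [transpose_transpose] at h

theorem cost_eq (S : LQR n m) (K : Gain m n) :
    S.cost K = (S.stageCost K * S.stateCov K).trace := rfl

/-- `tr (P W) = tr ((P - Mᵀ P M) Σ)` when `Σ = W + M Σ Mᵀ`. -/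
theorem trace_lyapunov_duality {M W Z P : Matrix (Fin n) (Fin n) ℝ} (hZ : Z = W + M * Z * Mᵀ) :
    (P * W).trace = ((P - Mᵀ * P * M) * Z).trace := by
  have h : W = Z - M * Z * Mᵀ := by rw [eq_sub_iff_add_eq]; exact hZ.symm
  rw [h, Matrix.mul_sub, Matrix.sub_mul, trace_sub, trace_sub]
  congr 1
  calc (P * (M * Z * Mᵀ)).trace = ((P * M * Z) * Mᵀ).trace := by simp only [Matrix.mul_assoc]
    _ = (Mᵀ * (P * M * Z)).trace := trace_mul_comm _ _
    _ = _ := by simp only [Matrix.mul_assoc]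

theorem Bounded.cost_eq_trace_valueMat (hS : S.Bounded β₀ σw ψ) (hK : S.Stabilizing K) :
    S.cost K = (S.valueMat K * S.W).trace := by
  rw [trace_lyapunov_duality (hS.stateCov_spec hK).2, cost_eq]
  congr 2
  rw [eq_sub_iff_add_eq]
  exact (hS.valueMat_spec hK).2.symm

theorem closedLoop_add (K Δ : Gain m n) :
    S.closedLoop (K + Δ) = S.closedLoop K + S.B * Δ.toMat := by
  rw [closedLoop, closedLoop, Gain.toMat_add, Matrix.mul_add, add_assoc]

/-- Exact expansion of the cost difference of two stabilizing gains. -/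
theorem Bounded.cost_sub (hS : S.Bounded β₀ σw ψ) {Δ : Gain m n} (hK : S.Stabilizing K)
    (hK' : S.Stabilizing (K + Δ)) :
    S.cost (K + Δ) - S.cost K =
      ((Δ.toMatᵀ * S.gradFactor K + (S.gradFactor K)ᵀ * Δ.toMat) * S.stateCov (K + Δ)).trace +
      (Δ.toMatᵀ * (S.R + S.Bᵀ * S.valueMat K * S.B) * Δ.toMat * S.stateCov (K + Δ)).trace := by
  -- $J(K)=\mathrm{tr}(P_KW)$ no longer involves $\Sigma_K$; eliminating $W$ through the perturbed
  -- Lyapunov equation puts both costs against $\Sigma_{K+\Delta}$.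
  rw [hS.cost_eq_trace_valueMat hK, trace_lyapunov_duality (hS.stateCov_spec hK').2, cost_eq,
    ← trace_sub, ← Matrix.sub_mul, ← trace_add, ← Matrix.add_mul]
  congr 2
  have hP := hS.valueMat_spec hK
  have hPT := transpose_eq_of_posSemidef hP.1
  have hRT := transpose_eq_of_posSemidef hS.psdR
  rw [closedLoop_add, gradFactor, stageCost, Gain.toMat_add]
  nth_rw 1 [hP.2]
  rw [stageCost]
  simp only [transpose_add, transpose_mul, transpose_transpose, hPT, hRT, Matrix.mul_add,
    Matrix.add_mul, Matrix.mul_assoc]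
  abel

theorem Bounded.trace_stateCov_le (hS : S.Bounded β₀ σw ψ) (hK : S.Stabilizing K) :
    β₀ * (S.stateCov K).trace ≤ S.cost K :=
  le_trace_mul_of_le_quadForm (hS.stateCov_spec hK).1 hS.le_stageCost

theorem Bounded.trace_valueMat_le (hS : S.Bounded β₀ σw ψ) (hK : S.Stabilizing K) :
    σw ^ 2 * (S.valueMat K).trace ≤ S.cost K := by
  rw [hS.cost_eq_trace_valueMat hK, trace_mul_comm]
  exact le_trace_mul_of_le_quadForm (hS.valueMat_spec hK).1 hS.le_W

theorem Bounded.quadForm_stateCov (hS : S.Bounded β₀ σw ψ) (hK : S.Stabilizing K)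
    (x : Fin n → ℝ) :
    x ⬝ᵥ S.stateCov K *ᵥ x = x ⬝ᵥ S.W *ᵥ x +
      ((S.closedLoop K)ᵀ *ᵥ x) ⬝ᵥ S.stateCov K *ᵥ ((S.closedLoop K)ᵀ *ᵥ x) := by
  have h := dotProduct_congruence (S.stateCov K) (S.closedLoop K)ᵀ (S.closedLoop K)ᵀ x x
  rw [transpose_transpose] at h
  rw [← h, ← dotProduct_add, ← add_mulVec, ← (hS.stateCov_spec hK).2]

theorem Bounded.le_stateCov (hS : S.Bounded β₀ σw ψ) (hK : S.Stabilizing K) (x : Fin n → ℝ) :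
    σw ^ 2 * (x ⬝ᵥ x) ≤ x ⬝ᵥ S.stateCov K *ᵥ x := by
  rw [hS.quadForm_stateCov hK]
  linarith [hS.le_W x, quadForm_nonneg (hS.stateCov_spec hK).1 ((S.closedLoop K)ᵀ *ᵥ x)]

theorem Bounded.dimension_le_cost (hS : S.Bounded β₀ σw ψ) (hK : S.Stabilizing K) :
    β₀ * σw ^ 2 * n ≤ S.cost K := by
  have h := le_trace_mul_of_le_quadForm (Matrix.PosSemidef.one (n := Fin n)) (hS.le_stateCov hK)
  rw [Matrix.mul_one, trace_one, Fintype.card_fin] at h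
  have := mul_le_mul_of_nonneg_left h hS.pos.le
  linarith [hS.trace_stateCov_le hK]

theorem Bounded.stateCov_le {J : ℝ} (hS : S.Bounded β₀ σw ψ) (hK : S.Stabilizing K)
    (hJ : S.cost K ≤ J) (x : Fin n → ℝ) :
    x ⬝ᵥ S.stateCov K *ᵥ x ≤ J / β₀ * (x ⬝ᵥ x) := by
  refine (quadForm_le_trace_mul (hS.stateCov_spec hK).1 x).trans ?_
  refine mul_le_mul_of_nonneg_right ?_ (dotProduct_self_nonneg' x)
  rw [le_div_iff₀ hS.pos, mul_comm]
  exact (hS.trace_stateCov_le hK).trans hJ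

theorem Bounded.trace_valueMat_le_div {J : ℝ} (hS : S.Bounded β₀ σw ψ) (hK : S.Stabilizing K)
    (hJ : S.cost K ≤ J) : (S.valueMat K).trace ≤ J / σw ^ 2 := by
  rw [le_div_iff₀ (pow_pos hS.noise_pos 2), mul_comm]
  exact (hS.trace_valueMat_le hK).trans hJ

theorem quadForm_hessian (P : Matrix (Fin n) (Fin n) ℝ) (y : Fin m → ℝ) :
    y ⬝ᵥ (S.R + S.Bᵀ * P * S.B) *ᵥ y =
      y ⬝ᵥ S.R *ᵥ y + (S.B *ᵥ y) ⬝ᵥ P *ᵥ (S.B *ᵥ y) := by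
  rw [add_mulVec, dotProduct_add, dotProduct_congruence]

theorem Bounded.hessian_le {J : ℝ} (hS : S.Bounded β₀ σw ψ) (hK : S.Stabilizing K)
    (hJ : S.cost K ≤ J) (y : Fin m → ℝ) :
    y ⬝ᵥ (S.R + S.Bᵀ * S.valueMat K * S.B) *ᵥ y ≤ (1 + ψ ^ 2 * (J / σw ^ 2)) * (y ⬝ᵥ y) := by
  rw [quadForm_hessian]
  have hP := (hS.valueMat_spec hK).1
  have h1 := quadForm_le_trace_mul hP (S.B *ᵥ y)
  have h2 := hS.trace_valueMat_le_div hK hJ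
  have h3 := mul_le_mul_of_nonneg_right h2 (dotProduct_self_nonneg' (S.B *ᵥ y))
  have h4 : 0 ≤ J / σw ^ 2 := hP.trace_nonneg.trans h2
  have h5 := mul_le_mul_of_nonneg_left (hS.B_le y) h4
  linarith [hS.R_le y]

theorem gradFactor_mulVec (x : Fin n → ℝ) (y : Fin m → ℝ) :
    y ⬝ᵥ S.gradFactor K *ᵥ x = y ⬝ᵥ S.R *ᵥ (K.toMat *ᵥ x) +
      (S.B *ᵥ y) ⬝ᵥ S.valueMat K *ᵥ (S.closedLoop K *ᵥ x) := by
  rw [gradFactor, add_mulVec, dotProduct_add, dotProduct_congruence]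
  simp only [mulVec_mulVec]

/-- With $y=E_Kx$, Young's inequality of weight $l^{-1}$, where $R+B^\top P_KB\preceq l$, gives
$2|y|^2\le|y|^2+l\,x^\top P_Kx$. The Lyapunov equation for $P_K$ absorbs the remaining terms. -/
theorem Bounded.gradFactor_sq_le {J : ℝ} (hS : S.Bounded β₀ σw ψ) (hK : S.Stabilizing K)
    (hJ : S.cost K ≤ J) (x : Fin n → ℝ) :
    (S.gradFactor K *ᵥ x) ⬝ᵥ (S.gradFactor K *ᵥ x) ≤
      (1 + ψ ^ 2 * (J / σw ^ 2)) * (x ⬝ᵥ S.valueMat K *ᵥ x) := by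
  set l := 1 + ψ ^ 2 * (J / σw ^ 2) with hl
  set y := S.gradFactor K *ᵥ x with hy
  have hP := hS.valueMat_spec hK
  have hl0 : 0 < l := by
    have := hP.1.trace_nonneg.trans (hS.trace_valueMat_le_div hK hJ)
    positivity
  have hli : 0 < l⁻¹ := inv_pos.2 hl0
  have e1 := gradFactor_mulVec (S := S) (K := K) x y
  have h1 := two_mul_bilinForm_le hS.psdR hli y (K.toMat *ᵥ x)
  have h2 := two_mul_bilinForm_le hP.1 hli (S.B *ᵥ y) (S.closedLoop K *ᵥ x)
  have h3 := hS.hessian_le hK hJ y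
  rw [quadForm_hessian, ← hl] at h3
  have h4 := mul_le_mul_of_nonneg_left h3 hli.le
  rw [← mul_assoc, inv_mul_cancel₀ hl0.ne', one_mul] at h4
  rw [inv_inv] at h1 h2
  have e2 : x ⬝ᵥ S.valueMat K *ᵥ x = x ⬝ᵥ S.stageCost K *ᵥ x +
      (S.closedLoop K *ᵥ x) ⬝ᵥ S.valueMat K *ᵥ (S.closedLoop K *ᵥ x) := by
    rw [← dotProduct_congruence, ← dotProduct_add, ← add_mulVec, ← hP.2]
  rw [quadForm_stageCost] at e2
  have h5 := mul_nonneg hl0.le (quadForm_nonneg hS.psdQ x)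
  rw [← hy] at e1
  have h6 := le_abs_self (y ⬝ᵥ S.R *ᵥ (K.toMat *ᵥ x))
  have h7 := le_abs_self ((S.B *ᵥ y) ⬝ᵥ S.valueMat K *ᵥ (S.closedLoop K *ᵥ x))
  rw [e2]
  linarith

theorem Bounded.trace_gradFactor_le {J : ℝ} (hS : S.Bounded β₀ σw ψ) (hK : S.Stabilizing K)
    (hJ : S.cost K ≤ J) :
    ((S.gradFactor K)ᵀ * S.gradFactor K * S.stateCov K).trace ≤
      (1 + ψ ^ 2 * (J / σw ^ 2)) * (J / β₀ * (J / σw ^ 2)) := by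
  have hP := (hS.valueMat_spec hK).1
  have hp := hS.trace_valueMat_le_div hK hJ
  have hp0 : 0 ≤ J / σw ^ 2 := hP.trace_nonneg.trans hp
  have hs0 : 0 ≤ J / β₀ := by
    have := (div_nonneg_iff.1 hp0)
    have hJ0 : 0 ≤ J := by
      rcases this with h | h
      · exact h.1
      · exact absurd h.2 (not_le.2 (pow_pos hS.noise_pos 2))
    exact div_nonneg hJ0 hS.pos.le
  have h1 := trace_mul_le_trace_mul (X := (S.gradFactor K)ᵀ * S.gradFactor K)
    (Y := (1 + ψ ^ 2 * (J / σw ^ 2)) • S.valueMat K) (hS.stateCov_spec hK).1 fun x => by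
      rw [dotProduct_transpose_mul_mulVec, smul_mulVec, dotProduct_smul, smul_eq_mul]
      exact hS.gradFactor_sq_le hK hJ x
  refine h1.trans ?_
  rw [Matrix.smul_mul, trace_smul, smul_eq_mul, trace_mul_comm]
  refine mul_le_mul_of_nonneg_left ?_ (by positivity)
  exact (trace_mul_le_of_quadForm_le hP (hS.stateCov_le hK hJ)).trans
    (mul_le_mul_of_nonneg_left hp hs0)

theorem Bounded.norm_sq_policyGrad (hS : S.Bounded β₀ σw ψ) (hK : S.Stabilizing K) :
    ‖S.policyGrad K‖ ^ 2 =
      4 * (S.stateCov K * S.stateCov K * ((S.gradFactor K)ᵀ * S.gradFactor K)).trace := by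
  have hT := transpose_eq_of_posSemidef (hS.stateCov_spec hK).1
  rw [Gain.norm_sq_eq_trace, policyGrad, Gain.toMat_ofMat, transpose_smul, Matrix.smul_mul,
    Matrix.mul_smul, smul_smul, trace_smul, transpose_mul, hT, smul_eq_mul]
  norm_num
  rw [Matrix.mul_assoc, trace_mul_comm, trace_mul_comm (S.stateCov K * S.stateCov K)]
  simp only [Matrix.mul_assoc]

theorem Bounded.norm_policyGrad_sq_le {J : ℝ} (hS : S.Bounded β₀ σw ψ) (hK : S.Stabilizing K)
    (hJ : S.cost K ≤ J) :
    ‖S.policyGrad K‖ ^ 2 ≤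
      4 * (J / β₀ * ((1 + ψ ^ 2 * (J / σw ^ 2)) * (J / β₀ * (J / σw ^ 2)))) := by
  rw [hS.norm_sq_policyGrad hK]
  refine mul_le_mul_of_nonneg_left ?_ (by norm_num)
  have hZ := (hS.stateCov_spec hK).1
  have h1 := trace_mul_le_trace_mul (X := S.stateCov K * S.stateCov K)
    (Y := (J / β₀) • S.stateCov K) (transpose_mul_self_posSemidef (S.gradFactor K)) fun x => by
      rw [smul_mulVec, dotProduct_smul, smul_eq_mul]
      exact quadForm_mul_self_le hZ (hS.stateCov_le hK hJ) x
  refine h1.trans ?_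
  rw [Matrix.smul_mul, trace_smul, smul_eq_mul, trace_mul_comm]
  have hs0 : 0 ≤ J / β₀ := div_nonneg ((mul_nonneg hS.pos.le hZ.trace_nonneg).trans
    ((hS.trace_stateCov_le hK).trans hJ)) hS.pos.le
  exact mul_le_mul_of_nonneg_left (hS.trace_gradFactor_le hK hJ) hs0

theorem Bounded.le_norm_policyGrad_sq (hS : S.Bounded β₀ σw ψ) (hK : S.Stabilizing K) :
    4 * (σw ^ 4 * ((S.gradFactor K)ᵀ * S.gradFactor K).trace) ≤ ‖S.policyGrad K‖ ^ 2 := by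
  rw [hS.norm_sq_policyGrad hK]
  refine mul_le_mul_of_nonneg_left ?_ (by norm_num)
  have hZ := (hS.stateCov_spec hK).1
  refine le_trace_mul_of_le_quadForm (transpose_mul_self_posSemidef (S.gradFactor K)) fun x => ?_
  have := le_quadForm_mul_self (sq_nonneg σw) (transpose_eq_of_posSemidef hZ)
    (hS.le_stateCov hK) x
  rwa [← pow_mul] at this

/-- Gradient domination against an arbitrary stabilizing gain of cost at most `J`. -/
theorem Bounded.cost_sub_le_norm_sq {J : ℝ} (hS : S.Bounded β₀ σw ψ) (hK : S.Stabilizing K)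
    (hK' : S.Stabilizing K') (hJ : S.cost K' ≤ J) :
    S.cost K - S.cost K' ≤ J / (4 * β₀ ^ 2 * σw ^ 4) * ‖S.policyGrad K‖ ^ 2 := by
  obtain ⟨Δ, rfl⟩ : ∃ Δ, K' = K + Δ := ⟨K' - K, by abel⟩
  have hZ' := (hS.stateCov_spec hK').1
  have hP := (hS.valueMat_spec hK).1
  have h0 := hS.cost_sub hK hK'
  rw [← trace_add, ← Matrix.add_mul] at h0
  set E := S.gradFactor K with hE
  -- Completing the square: the Hessian term is at least $\beta_0\Delta^\top\Delta$, so the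
  -- quadratic in $\Delta$ is at least $-\beta_0^{-1}E^\top E$.
  have h1 := trace_mul_le_trace_mul (X := (-β₀⁻¹) • (Eᵀ * E))
    (Y := Δ.toMatᵀ * E + Eᵀ * Δ.toMat +
      Δ.toMatᵀ * (S.R + S.Bᵀ * S.valueMat K * S.B) * Δ.toMat) hZ' fun x => by
    rw [add_mulVec, add_mulVec, dotProduct_add, dotProduct_add, dotProduct_congruence,
      smul_mulVec, dotProduct_smul, dotProduct_transpose_mul_mulVec,
      dotProduct_transpose_mul_mulVec,
      dotProduct_transpose_mul_mulVec,
      quadForm_hessian, smul_eq_mul, dotProduct_comm (E *ᵥ x) (Δ.toMat *ᵥ x)]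
    have h2 := hS.le_R (Δ.toMat *ᵥ x)
    have h3 := quadForm_nonneg hP (S.B *ᵥ (Δ.toMat *ᵥ x))
    have h4 := two_mul_bilinForm_le (Matrix.PosSemidef.one (n := Fin m) (R := ℝ)) hS.pos
      (Δ.toMat *ᵥ x) (E *ᵥ x)
    simp only [one_mulVec] at h4
    linarith [neg_abs_le ((Δ.toMat *ᵥ x) ⬝ᵥ (E *ᵥ x))]
  rw [← h0, Matrix.smul_mul, trace_smul, smul_eq_mul, trace_mul_comm] at h1
  have h5 := trace_mul_le_of_quadForm_le (transpose_mul_self_posSemidef E)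
    (hS.stateCov_le hK' hJ)
  have h6 := hS.le_norm_policyGrad_sq hK
  rw [← hE] at h6
  have hb := hS.pos
  have hw := hS.noise_pos
  have hs0 : 0 ≤ J := ((mul_nonneg hS.pos.le hZ'.trace_nonneg).trans
    ((hS.trace_stateCov_le hK').trans hJ))
  have h7 : S.cost K - S.cost (K + Δ) ≤ β₀⁻¹ * (J / β₀ * (Eᵀ * E).trace) := by
    have := mul_le_mul_of_nonneg_left h5 (inv_nonneg.2 hb.le)
    linarith
  have hc : 0 ≤ J / (4 * β₀ ^ 2 * σw ^ 4) := by positivity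
  refine h7.trans (le_trans (le_of_eq ?_) (mul_le_mul_of_nonneg_left h6 hc))
  field_simp

end LQR

end LQRPower

/-! ### Perturbation of the covariance and second-order expansion of the cost -/

namespace LQRPower

open Matrix Filter Topology

namespace LQR

variable {n m : ℕ} {S : LQR n m} {β₀ σw ψ J ζ : ℝ} {K Δ : Gain m n}

/-- The closed loop contracts the norm of its stationary covariance. -/
theorem Bounded.stateCov_closedLoop_le (hS : S.Bounded β₀ σw ψ) (hK : S.Stabilizing K)
    (hJ : S.cost K ≤ J) (hζ : 1 ≤ ζ) (hζJ : J = β₀ * σw ^ 2 * ζ ^ 2) (x : Fin n → ℝ) :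
    ((S.closedLoop K)ᵀ *ᵥ x) ⬝ᵥ S.stateCov K *ᵥ ((S.closedLoop K)ᵀ *ᵥ x) ≤
      (1 - 1 / ζ ^ 2) * (x ⬝ᵥ S.stateCov K *ᵥ x) := by
  have h1 := hS.quadForm_stateCov hK x
  have h2 := hS.le_W x
  have h3 := hS.stateCov_le hK hJ x
  have hb := hS.pos
  have e : J / β₀ = σw ^ 2 * ζ ^ 2 := by rw [hζJ]; field_simp
  rw [e] at h3
  -- Since $\Sigma_K\preceq\sigma_w^2\zeta^2I$, the noise term $W$ is at least the fraction
  -- $\zeta^{-2}$ of $\Sigma_K$.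
  have h4 : 1 / ζ ^ 2 * (x ⬝ᵥ S.stateCov K *ᵥ x) ≤ σw ^ 2 * (x ⬝ᵥ x) := by
    rw [one_div, inv_mul_le_iff₀ (by positivity)]
    linarith
  linarith

theorem Bounded.stateCov_gain_le (hS : S.Bounded β₀ σw ψ) (hK : S.Stabilizing K)
    (hJ : S.cost K ≤ J) (hζJ : J = β₀ * σw ^ 2 * ζ ^ 2) (x : Fin n → ℝ) :
    ((S.B * Δ.toMat)ᵀ *ᵥ x) ⬝ᵥ S.stateCov K *ᵥ ((S.B * Δ.toMat)ᵀ *ᵥ x) ≤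
      (ψ * ‖Δ‖ * ζ) ^ 2 * (x ⬝ᵥ S.stateCov K *ᵥ x) := by
  have hb := hS.pos
  have e : J / β₀ = σw ^ 2 * ζ ^ 2 := by rw [hζJ]; field_simp
  have h1 := hS.stateCov_le hK hJ ((S.B * Δ.toMat)ᵀ *ᵥ x)
  have h2 : ((S.B * Δ.toMat)ᵀ *ᵥ x) ⬝ᵥ ((S.B * Δ.toMat)ᵀ *ᵥ x) ≤
      ‖Δ‖ ^ 2 * ((S.Bᵀ *ᵥ x) ⬝ᵥ (S.Bᵀ *ᵥ x)) := by
    have h3 := quadForm_le_trace_mul (transpose_mul_self_posSemidef Δ.toMatᵀ) (S.Bᵀ *ᵥ x)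
    rw [dotProduct_transpose_mul_mulVec, trace_mul_comm, transpose_transpose, ← trace_transpose,
      transpose_mul, transpose_transpose, mulVec_mulVec, ← transpose_mul] at h3
    rw [Gain.norm_sq_eq_trace]
    convert h3 using 2
  have h4 := hS.Bt_le x
  have h5 := hS.le_stateCov hK x
  rw [e] at h1
  calc _ ≤ _ := h1
    _ ≤ σw ^ 2 * ζ ^ 2 * (‖Δ‖ ^ 2 * (ψ ^ 2 * (x ⬝ᵥ x))) := by gcongr; exact h2.trans (by gcongr)
    _ = (ψ * ‖Δ‖ * ζ) ^ 2 * (σw ^ 2 * (x ⬝ᵥ x)) := by ring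
    _ ≤ _ := by gcongr

theorem Bounded.abs_stateCov_closedLoop_sub_le (hS : S.Bounded β₀ σw ψ) (hK : S.Stabilizing K)
    (hJ : S.cost K ≤ J) (hζ : 1 ≤ ζ) (hζJ : J = β₀ * σw ^ 2 * ζ ^ 2)
    (hΔ : ψ * ‖Δ‖ * ζ ≤ 1) (x : Fin n → ℝ) :
    |((S.closedLoop (K + Δ))ᵀ *ᵥ x) ⬝ᵥ S.stateCov K *ᵥ ((S.closedLoop (K + Δ))ᵀ *ᵥ x) -
      ((S.closedLoop K)ᵀ *ᵥ x) ⬝ᵥ S.stateCov K *ᵥ ((S.closedLoop K)ᵀ *ᵥ x)| ≤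
      3 * (ψ * ‖Δ‖ * ζ) * (x ⬝ᵥ S.stateCov K *ᵥ x) := by
  have hZ := (hS.stateCov_spec hK).1
  have hT := transpose_eq_of_posSemidef hZ
  set ε := ψ * ‖Δ‖ * ζ with hε
  have hψ := hS.one_le
  have hε0 : 0 ≤ ε := by positivity
  rw [closedLoop_add, transpose_add, add_mulVec, quadForm_add hT]
  set u := (S.closedLoop K)ᵀ *ᵥ x
  set v := (S.B * Δ.toMat)ᵀ *ᵥ x
  set w := x ⬝ᵥ S.stateCov K *ᵥ x
  have hw : 0 ≤ w := quadForm_nonneg hZ x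
  have h1 : u ⬝ᵥ S.stateCov K *ᵥ u ≤ w := by
    have h := hS.stateCov_closedLoop_le hK hJ hζ hζJ x
    have h' : 0 ≤ 1 / ζ ^ 2 * w := by positivity
    change u ⬝ᵥ S.stateCov K *ᵥ u ≤ (1 - 1 / ζ ^ 2) * w at h
    linarith
  have h2 : v ⬝ᵥ S.stateCov K *ᵥ v ≤ ε ^ 2 * w := hS.stateCov_gain_le hK hJ hζJ x
  have hv : 0 ≤ v ⬝ᵥ S.stateCov K *ᵥ v := quadForm_nonneg hZ v
  have h3 : |u ⬝ᵥ S.stateCov K *ᵥ v| ≤ ε * w := by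
    refine abs_le_of_sq_le_sq ?_ (by positivity)
    calc _ ≤ _ := bilinForm_sq_le hZ u v
      _ ≤ w * (ε ^ 2 * w) := mul_le_mul h1 h2 hv hw
      _ = _ := by ring
  -- The cross term contributes $2\varepsilon w$ and the square $\varepsilon^2w\le\varepsilon w$,
  -- whence the 3.
  have h4 : ε ^ 2 * w ≤ ε * w := by
    refine mul_le_mul_of_nonneg_right ?_ hw
    nlinarith
  have h5 := abs_le.1 h3
  rw [abs_le]
  constructor <;> linarith

theorem Bounded.stateCov_perturbed_closedLoop_le (hS : S.Bounded β₀ σw ψ)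
    (hK : S.Stabilizing K) (hJ : S.cost K ≤ J) (hζ : 1 ≤ ζ) (hζJ : J = β₀ * σw ^ 2 * ζ ^ 2)
    (hΔ : 6 * (ψ * ‖Δ‖ * ζ ^ 3) ≤ 1) (x : Fin n → ℝ) :
    ((S.closedLoop (K + Δ))ᵀ *ᵥ x) ⬝ᵥ S.stateCov K *ᵥ ((S.closedLoop (K + Δ))ᵀ *ᵥ x) ≤
      (1 - 1 / (2 * ζ ^ 2)) * (x ⬝ᵥ S.stateCov K *ᵥ x) := by
  have hψ := hS.one_le
  have hd0 : 0 ≤ ψ * ‖Δ‖ := by positivity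
  have h1 : ψ * ‖Δ‖ * ζ ≤ 1 := by
    have : ψ * ‖Δ‖ * ζ ≤ ψ * ‖Δ‖ * ζ ^ 3 :=
      mul_le_mul_of_nonneg_left (le_self_pow₀ hζ (by norm_num)) hd0
    have : 0 ≤ ψ * ‖Δ‖ * ζ ^ 3 := by positivity
    linarith
  have h2 := hS.abs_stateCov_closedLoop_sub_le hK hJ hζ hζJ h1 x
  have h3 := hS.stateCov_closedLoop_le hK hJ hζ hζJ x
  have hw := quadForm_nonneg (hS.stateCov_spec hK).1 x
  have h4 : 3 * (ψ * ‖Δ‖ * ζ) ≤ 1 / (2 * ζ ^ 2) := by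
    rw [le_div_iff₀ (by positivity)]
    linarith
  have h5 := mul_le_mul_of_nonneg_right h4 hw
  have h6 : 1 / (2 * ζ ^ 2) = 1 / ζ ^ 2 - 1 / (2 * ζ ^ 2) := by field_simp; norm_num
  have h7 := (abs_le.1 h2).2
  have h8 : (1 - 1 / ζ ^ 2) * (x ⬝ᵥ S.stateCov K *ᵥ x) +
      1 / (2 * ζ ^ 2) * (x ⬝ᵥ S.stateCov K *ᵥ x) =
      (1 - 1 / (2 * ζ ^ 2)) * (x ⬝ᵥ S.stateCov K *ᵥ x) := by
    rw [← add_mul]; congr 1; linarith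
  linarith

theorem Bounded.stabilizing_add (hS : S.Bounded β₀ σw ψ) (hK : S.Stabilizing K)
    (hJ : S.cost K ≤ J) (hζ : 1 ≤ ζ) (hζJ : J = β₀ * σw ^ 2 * ζ ^ 2)
    (hΔ : 6 * (ψ * ‖Δ‖ * ζ ^ 3) ≤ 1) : S.Stabilizing (K + Δ) := by
  have h1 : 1 / (2 * ζ ^ 2) ≤ 1 := by
    rw [div_le_one (by positivity)]
    nlinarith
  have h2 : 0 < 1 / (2 * ζ ^ 2) := by positivity
  refine isSchurStable_of_tendsto_pow (tendsto_pow_of_contraction (S := S.stateCov K)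
    (pow_pos hS.noise_pos 2) (hS.le_stateCov hK) (q := 1 - 1 / (2 * ζ ^ 2)) (by linarith)
    (by linarith) fun x => ?_)
  have h := dotProduct_congruence (S.stateCov K) (S.closedLoop (K + Δ))ᵀ
    (S.closedLoop (K + Δ))ᵀ x x
  rw [transpose_transpose] at h
  rw [h]
  exact hS.stateCov_perturbed_closedLoop_le hK hJ hζ hζJ hΔ x

/-- Perturbation of the stationary covariance, relative to itself. -/
theorem Bounded.abs_stateCov_sub_le (hS : S.Bounded β₀ σw ψ) (hK : S.Stabilizing K)
    (hJ : S.cost K ≤ J) (hζ : 1 ≤ ζ) (hζJ : J = β₀ * σw ^ 2 * ζ ^ 2)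
    (hΔ : 6 * (ψ * ‖Δ‖ * ζ ^ 3) ≤ 1) (x : Fin n → ℝ) :
    |x ⬝ᵥ (S.stateCov (K + Δ) - S.stateCov K) *ᵥ x| ≤
      6 * (ψ * ‖Δ‖ * ζ ^ 3) * (x ⬝ᵥ S.stateCov K *ᵥ x) := by
  have hK' := hS.stabilizing_add hK hJ hζ hζJ hΔ
  have hψ := hS.one_le
  have hd0 : 0 ≤ ψ * ‖Δ‖ := by positivity
  have h1 : ψ * ‖Δ‖ * ζ ≤ 1 := by
    have : ψ * ‖Δ‖ * ζ ≤ ψ * ‖Δ‖ * ζ ^ 3 :=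
      mul_le_mul_of_nonneg_left (le_self_pow₀ hζ (by norm_num)) hd0
    have : 0 ≤ ψ * ‖Δ‖ * ζ ^ 3 := by positivity
    linarith
  have key : ∀ c : ℝ, |c| = 1 → ∀ x,
      0 ≤ x ⬝ᵥ ((6 * (ψ * ‖Δ‖ * ζ ^ 3)) • S.stateCov K +
        c • (S.stateCov (K + Δ) - S.stateCov K)) *ᵥ x := by
    intro c hc
    have hexp : ∀ y : Fin n → ℝ, y ⬝ᵥ ((6 * (ψ * ‖Δ‖ * ζ ^ 3)) • S.stateCov K +
        c • (S.stateCov (K + Δ) - S.stateCov K)) *ᵥ y =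
        6 * (ψ * ‖Δ‖ * ζ ^ 3) * (y ⬝ᵥ S.stateCov K *ᵥ y) +
          c * (y ⬝ᵥ S.stateCov (K + Δ) *ᵥ y - y ⬝ᵥ S.stateCov K *ᵥ y) := fun y => by
      simp only [add_mulVec, smul_mulVec, sub_mulVec, dotProduct_add, dotProduct_smul,
        dotProduct_sub, smul_eq_mul]
    -- Lyapunov comparison under the perturbed loop: the source of $\Sigma_{K+\Delta}-\Sigma_K$ is
    -- at most $3\psi\|\Delta\|\zeta\,\Sigma_K$ in size. The contraction by $1-1/(2\zeta^2)$ of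
    -- $6\psi\|\Delta\|\zeta^3\,\Sigma_K$ releases exactly that amount.
    refine quadForm_nonneg_of_congruence_le (IsSchurStable.tendsto_pow hK') fun x => ?_
    have h := dotProduct_congruence ((6 * (ψ * ‖Δ‖ * ζ ^ 3)) • S.stateCov K +
        c • (S.stateCov (K + Δ) - S.stateCov K)) (S.closedLoop (K + Δ))ᵀ
      (S.closedLoop (K + Δ))ᵀ x x
    rw [transpose_transpose] at h
    rw [h, hexp, hexp, hS.quadForm_stateCov hK' x, mul_comm c, mul_comm c]
    have h2 := hS.abs_stateCov_closedLoop_sub_le hK hJ hζ hζJ h1 x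
    have h3 := hS.stateCov_perturbed_closedLoop_le hK hJ hζ hζJ hΔ x
    have h4 := hS.quadForm_stateCov hK x
    set a := ((S.closedLoop (K + Δ))ᵀ *ᵥ x) ⬝ᵥ S.stateCov K *ᵥ ((S.closedLoop (K + Δ))ᵀ *ᵥ x)
    set b := ((S.closedLoop K)ᵀ *ᵥ x) ⬝ᵥ S.stateCov K *ᵥ ((S.closedLoop K)ᵀ *ᵥ x)
    set w := x ⬝ᵥ S.stateCov K *ᵥ x
    have h5 : -(3 * (ψ * ‖Δ‖ * ζ) * w) ≤ c * (a - b) := by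
      have : |c * (a - b)| ≤ 3 * (ψ * ‖Δ‖ * ζ) * w := by rwa [abs_mul, hc, one_mul]
      exact (abs_le.1 this).1
    have h6 : 6 * (ψ * ‖Δ‖ * ζ ^ 3) * a ≤
        6 * (ψ * ‖Δ‖ * ζ ^ 3) * ((1 - 1 / (2 * ζ ^ 2)) * w) :=
      mul_le_mul_of_nonneg_left h3 (by positivity)
    have h7 : 6 * (ψ * ‖Δ‖ * ζ ^ 3) * ((1 - 1 / (2 * ζ ^ 2)) * w) =
        6 * (ψ * ‖Δ‖ * ζ ^ 3) * w - 3 * (ψ * ‖Δ‖ * ζ) * w := by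
      field_simp
      ring
    have h8 : c * (x ⬝ᵥ S.W *ᵥ x) = c * (w - b) := by linear_combination (-c) * h4
    linarith
  have e : ∀ c : ℝ, x ⬝ᵥ ((6 * (ψ * ‖Δ‖ * ζ ^ 3)) • S.stateCov K +
        c • (S.stateCov (K + Δ) - S.stateCov K)) *ᵥ x =
        6 * (ψ * ‖Δ‖ * ζ ^ 3) * (x ⬝ᵥ S.stateCov K *ᵥ x) +
          c * (x ⬝ᵥ (S.stateCov (K + Δ) - S.stateCov K) *ᵥ x) := fun c => by
      simp only [add_mulVec, smul_mulVec, dotProduct_add, dotProduct_smul, smul_eq_mul]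
  have hp := key 1 (by norm_num) x
  have hm := key (-1) (by norm_num) x
  rw [e] at hp hm
  rw [abs_le]
  constructor <;> linarith

theorem Bounded.trace_gain_stateCov_le (hS : S.Bounded β₀ σw ψ) (hK : S.Stabilizing K)
    (hJ : S.cost K ≤ J) :
    (Δ.toMatᵀ * Δ.toMat * S.stateCov K).trace ≤ J / β₀ * ‖Δ‖ ^ 2 := by
  rw [trace_mul_comm, Gain.norm_sq_eq_trace]
  exact trace_mul_le_of_quadForm_le (transpose_mul_self_posSemidef _) (hS.stateCov_le hK hJ)

theorem Bounded.inner_policyGrad (hS : S.Bounded β₀ σw ψ) (hK : S.Stabilizing K) :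
    inner ℝ (S.policyGrad K) Δ =
      ((Δ.toMatᵀ * S.gradFactor K + (S.gradFactor K)ᵀ * Δ.toMat) * S.stateCov K).trace := by
  have hT := transpose_eq_of_posSemidef (hS.stateCov_spec hK).1
  rw [Gain.inner_eq_trace, policyGrad, Gain.toMat_ofMat, transpose_smul, transpose_mul, hT,
    Matrix.smul_mul, trace_smul, Matrix.add_mul, trace_add, smul_eq_mul, two_mul,
    Matrix.mul_assoc, trace_mul_comm (S.stateCov K)]
  congr 1
  rw [← trace_transpose]
  simp only [transpose_mul, transpose_transpose, hT, Matrix.mul_assoc]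
  rw [trace_mul_comm]
  simp only [Matrix.mul_assoc]

/-- Second-order accuracy of the policy gradient near a gain of cost at most `J`. -/
theorem Bounded.abs_cost_sub_inner_le (hS : S.Bounded β₀ σw ψ) (hK : S.Stabilizing K)
    (hJ : S.cost K ≤ J) (hζ : 1 ≤ ζ) (hζJ : J = β₀ * σw ^ 2 * ζ ^ 2)
    (hΔ : 6 * (ψ * ‖Δ‖ * ζ ^ 3) ≤ 1) :
    |S.cost (K + Δ) - S.cost K - inner ℝ (S.policyGrad K) Δ| ≤
      58 * ψ ^ 2 * ζ ^ 5 * (J / β₀) * ‖Δ‖ ^ 2 := by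
  have hK' := hS.stabilizing_add hK hJ hζ hζJ hΔ
  rcases eq_or_ne Δ 0 with rfl | hΔ0
  · simp
  have hx : 0 < ‖Δ‖ := norm_pos_iff.2 hΔ0
  have hψ := hS.one_le
  have hb := hS.pos
  have hb1 := hS.le_one
  have hw := hS.noise_pos
  have hψ0 : 0 < ψ := by linarith
  have hζ0 : 0 < ζ := by linarith
  have hZ := (hS.stateCov_spec hK).1
  have hZ' := (hS.stateCov_spec hK').1
  have hP := (hS.valueMat_spec hK).1
  set δ := 6 * (ψ * ‖Δ‖ * ζ ^ 3) with hδ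
  have hδ0 : 0 ≤ δ := by positivity
  set E := S.gradFactor K with hE
  set H := S.R + S.Bᵀ * S.valueMat K * S.B with hH
  set X := S.stateCov (K + Δ) - S.stateCov K with hXdef
  set s := J / β₀ with hs
  set l := 1 + ψ ^ 2 * (J / σw ^ 2) with hl
  have hp : J / σw ^ 2 = β₀ * ζ ^ 2 := by rw [hζJ]; field_simp
  have hs' : s = σw ^ 2 * ζ ^ 2 := by rw [hs, hζJ]; field_simp
  have hs0 : 0 < s := by rw [hs']; positivity
  have hp1 : J / σw ^ 2 ≤ ζ ^ 2 := by
    rw [hp]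
    exact mul_le_of_le_one_left (by positivity) hb1
  have hp0 : 0 ≤ J / σw ^ 2 := by rw [hp]; positivity
  have hl0 : 0 ≤ l := by positivity
  have hl2 : l ≤ 2 * (ψ ^ 2 * ζ ^ 2) := by
    have h1 : 1 ≤ ψ ^ 2 * ζ ^ 2 := one_le_mul_of_one_le_of_one_le (one_le_pow₀ hψ) (one_le_pow₀ hζ)
    have h2 : ψ ^ 2 * (J / σw ^ 2) ≤ ψ ^ 2 * ζ ^ 2 := by gcongr
    linarith
  have hXS := hS.abs_stateCov_sub_le hK hJ hζ hζJ hΔ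
  have hsplit : S.cost (K + Δ) - S.cost K - inner ℝ (S.policyGrad K) Δ =
      ((Δ.toMatᵀ * E + Eᵀ * Δ.toMat) * X).trace +
        (Δ.toMatᵀ * H * Δ.toMat * S.stateCov (K + Δ)).trace := by
    rw [hS.cost_sub hK hK', hS.inner_policyGrad hK, hXdef, Matrix.mul_sub, trace_sub]
    ring
  have hfirst : |((Δ.toMatᵀ * E + Eᵀ * Δ.toMat) * X).trace| ≤
      54 * ψ ^ 2 * ζ ^ 5 * s * ‖Δ‖ ^ 2 := by
    -- This weight makes both halves of Young's inequality of order $\|\Delta\|$, with total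
    -- $3s\psi\zeta^2\|\Delta\|$. The factor $3\delta$ then gives $54=3\cdot6\cdot3$.
    set a := ψ * ζ ^ 2 / ‖Δ‖ with ha
    have ha0 : 0 < a := by positivity
    have hV : (a • (Δ.toMatᵀ * Δ.toMat) + a⁻¹ • (Eᵀ * E)).PosSemidef :=
      ((transpose_mul_self_posSemidef _).smul ha0.le).add
        ((transpose_mul_self_posSemidef _).smul (inv_nonneg.2 ha0.le))
    have h1 := abs_trace_mul_le hδ0 hZ
      (U := Δ.toMatᵀ * E + Eᵀ * Δ.toMat) (X := X)
      (by rw [hXdef, transpose_sub, transpose_eq_of_posSemidef hZ,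
        transpose_eq_of_posSemidef hZ']) hV hXS (fun x => by
          rw [add_mulVec, add_mulVec, dotProduct_add, dotProduct_add, smul_mulVec, smul_mulVec,
            dotProduct_smul, dotProduct_smul, dotProduct_transpose_mul_mulVec,
            dotProduct_transpose_mul_mulVec, dotProduct_transpose_mul_mulVec,
            dotProduct_transpose_mul_mulVec, dotProduct_comm (E *ᵥ x) (Δ.toMat *ᵥ x),
            smul_eq_mul, smul_eq_mul, ← two_mul, abs_mul, abs_two]
          simpa using two_mul_bilinForm_le (Matrix.PosSemidef.one (n := Fin m) (R := ℝ)) ha0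
            (Δ.toMat *ᵥ x) (E *ᵥ x))
    refine h1.trans ?_
    rw [Matrix.add_mul, Matrix.smul_mul, Matrix.smul_mul, trace_add, trace_smul, trace_smul,
      smul_eq_mul, smul_eq_mul]
    have h2 := mul_le_mul_of_nonneg_left (hS.trace_gain_stateCov_le (Δ := Δ) hK hJ) ha0.le
    have h3 := mul_le_mul_of_nonneg_left (hS.trace_gradFactor_le hK hJ) (inv_nonneg.2 ha0.le)
    have h4 : a⁻¹ * (l * (s * (J / σw ^ 2))) ≤
        a⁻¹ * (2 * (ψ ^ 2 * ζ ^ 2) * (s * ζ ^ 2)) := by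
      gcongr
    have e1 : a * (s * ‖Δ‖ ^ 2) = s * ψ * ζ ^ 2 * ‖Δ‖ := by
      rw [ha]; field_simp
    have e2 : a⁻¹ * (2 * (ψ ^ 2 * ζ ^ 2) * (s * ζ ^ 2)) = 2 * s * ψ * ζ ^ 2 * ‖Δ‖ := by
      rw [ha]; field_simp
    calc _ ≤ 3 * δ * (3 * s * ψ * ζ ^ 2 * ‖Δ‖) := by
          refine mul_le_mul_of_nonneg_left ?_ (by positivity)
          linarith
      _ = _ := by rw [hδ]; ring
  have hD0 : 0 ≤ (Δ.toMatᵀ * H * Δ.toMat * S.stateCov (K + Δ)).trace := by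
    have := trace_mul_le_trace_mul (X := 0) (Y := Δ.toMatᵀ * H * Δ.toMat) hZ' fun x => by
      rw [zero_mulVec, dotProduct_zero, dotProduct_congruence, hH, quadForm_hessian]
      exact add_nonneg (quadForm_nonneg hS.psdR _) (quadForm_nonneg hP _)
    simpa using this
  have hsecond : (Δ.toMatᵀ * H * Δ.toMat * S.stateCov (K + Δ)).trace ≤
      4 * ψ ^ 2 * ζ ^ 5 * s * ‖Δ‖ ^ 2 := by
    have h1 := trace_mul_le_trace_mul (X := Δ.toMatᵀ * H * Δ.toMat)
      (Y := l • (Δ.toMatᵀ * Δ.toMat)) hZ' fun x => by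
        rw [dotProduct_congruence, smul_mulVec, dotProduct_smul, dotProduct_transpose_mul_mulVec]
        exact hS.hessian_le hK hJ _
    have h2 := trace_mul_le_trace_mul (X := S.stateCov (K + Δ)) (Y := (2 : ℝ) • S.stateCov K)
      (transpose_mul_self_posSemidef Δ.toMat) fun x => by
        have h3 := (abs_le.1 (hXS x)).2
        rw [sub_mulVec, dotProduct_sub] at h3
        rw [smul_mulVec, dotProduct_smul, smul_eq_mul]
        have := mul_le_mul_of_nonneg_right hΔ (quadForm_nonneg hZ x)
        linarith
    have h4 := hS.trace_gain_stateCov_le (Δ := Δ) hK hJ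
    rw [Matrix.smul_mul, trace_smul, trace_mul_comm, trace_mul_comm (S.stateCov K),
      smul_eq_mul] at h2
    rw [Matrix.smul_mul, trace_smul, smul_eq_mul] at h1
    calc _ ≤ _ := h1
      _ ≤ l * (2 * (s * ‖Δ‖ ^ 2)) := by gcongr; linarith
      _ ≤ 2 * (ψ ^ 2 * ζ ^ 2) * (2 * (s * ‖Δ‖ ^ 2)) := by gcongr
      _ = 4 * ψ ^ 2 * ζ ^ 2 * s * ‖Δ‖ ^ 2 := by ring
      _ ≤ _ := by
        have : ζ ^ 2 ≤ ζ ^ 5 := pow_le_pow_right₀ hζ (by norm_num)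
        gcongr
  rw [hsplit]
  refine (abs_add_le _ _).trans ?_
  rw [abs_of_nonneg hD0]
  linarith

/-- The policy gradient is the gradient of the cost. -/
theorem Bounded.hasGradientAt_cost (hS : S.Bounded β₀ σw ψ) (hK : S.Stabilizing K)
    (hJ : S.cost K ≤ J) (hζ : 1 ≤ ζ) (hζJ : J = β₀ * σw ^ 2 * ζ ^ 2) :
    HasGradientAt S.cost (S.policyGrad K) K := by
  rw [hasGradientAt_iff_isLittleO_nhds_zero]
  have hψ := hS.one_le
  have hO : (fun Δ : Gain m n => S.cost (K + Δ) - S.cost K - inner ℝ (S.policyGrad K) Δ)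
      =O[𝓝 0] fun Δ => ‖Δ‖ ^ 2 := by
    refine Asymptotics.IsBigO.of_bound (58 * ψ ^ 2 * ζ ^ 5 * (J / β₀)) ?_
    have hlim : Tendsto (fun Δ : Gain m n => 6 * (ψ * ‖Δ‖ * ζ ^ 3)) (𝓝 0) (𝓝 0) := by
      have : Continuous fun Δ : Gain m n => 6 * (ψ * ‖Δ‖ * ζ ^ 3) := by fun_prop
      simpa using this.tendsto 0
    filter_upwards [hlim.eventually_le_const (by norm_num : (0 : ℝ) < 1)] with Δ hΔ
    simpa using hS.abs_cost_sub_inner_le hK hJ hζ hζJ hΔ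
  refine hO.trans_isLittleO ?_
  simpa using (Asymptotics.isLittleO_norm_pow_id (E' := Gain m n) (by norm_num : 1 < 2))

end LQR

end LQRPower

/-! ### The CtG power allocation -/

namespace LQRPower

section AllocationBounds

variable {T : ℕ} {pSq μ η lbSq : ℝ}

/-- The infimum is attained because $t=T-1$ qualifies: there the criterion reads $\sigma_{lb}^2\le
T\bar\sigma_p^2-(T-1)\sigma_{lb}^2$. -/
theorem ctgSwitch_spec (hT : 1 ≤ T) (hγ1 : gam μ η < 1) (hp : 0 < pSq) (hle : lbSq ≤ pSq) :
    ctgSwitch T pSq μ η lbSq < T ∧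
      gam μ η ^ (T - 1 - ctgSwitch T pSq μ η lbSq) ≥
        (1 - gam μ η ^ (T - ctgSwitch T pSq μ η lbSq)) / (1 - gam μ η) *
          (lbSq / (T * pSq - ctgSwitch T pSq μ η lbSq * lbSq)) := by
  refine Nat.sInf_mem (s := {t : ℕ | t < T ∧ gam μ η ^ (T - 1 - t) ≥
      (1 - gam μ η ^ (T - t)) / (1 - gam μ η) * (lbSq / (T * pSq - t * lbSq))})
    ⟨T - 1, by omega, ?_⟩
  have e : T - (T - 1) = 1 := by omega
  have e2 : ((T - 1 : ℕ) : ℝ) = T - 1 := by rw [Nat.cast_sub hT, Nat.cast_one]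
  have hT' : (1 : ℝ) ≤ T := by exact_mod_cast hT
  rw [e, pow_one, div_self (by linarith : 1 - gam μ η ≠ 0), one_mul, Nat.sub_self, pow_zero, e2]
  have h1 : (T - 1) * lbSq ≤ (T - 1) * pSq := mul_le_mul_of_nonneg_left hle (by linarith)
  rw [ge_iff_le, div_le_one (by nlinarith)]
  nlinarith

theorem ctgSwitch_eq_zero (hT : 1 ≤ T) (hγ : 0 < gam μ η) :
    ctgSwitch T pSq μ η 0 = 0 := by
  refine Nat.sInf_eq_zero.2 (Or.inl ⟨by omega, ?_⟩)
  rw [zero_div, mul_zero]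
  positivity

theorem remaining_budget_pos {t : ℕ} (ht : t < T) (hp : 0 < pSq)
    (hle : lbSq ≤ pSq) : 0 < T * pSq - t * lbSq := by
  have h1 : (t : ℝ) * lbSq ≤ t * pSq := mul_le_mul_of_nonneg_left hle (Nat.cast_nonneg t)
  have h2 : (t : ℝ) * pSq < T * pSq := mul_lt_mul_of_pos_right (by exact_mod_cast ht) hp
  linarith

theorem sum_pow_Ico_eq {γ : ℝ} (hγ : γ ≠ 1) {a : ℕ} :
    ∑ l ∈ Finset.Ico a T, γ ^ (T - l - 1) = (1 - γ ^ (T - a)) / (1 - γ) := by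
  rw [Finset.sum_Ico_eq_sum_range]
  have e : ∀ k ∈ Finset.range (T - a), γ ^ (T - (a + k) - 1) = γ ^ (T - a - 1 - k) :=
    fun k _ => by congr 1; omega
  rw [Finset.sum_congr rfl e, Finset.sum_range_reflect (fun k => γ ^ k) (T - a), geom_sum_eq hγ,
    ← neg_div_neg_eq, neg_sub, neg_sub]

theorem ctgPowerSq_bounds (hT : 1 ≤ T) (hγ : 0 < gam μ η) (hγ1 : gam μ η < 1) (hp : 0 < pSq)
    (hle : lbSq ≤ pSq) (hlb : 0 ≤ lbSq) {t : ℕ} (ht : t < T) :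
    0 < ctgPowerSq T pSq μ η lbSq t ∧ lbSq ≤ ctgPowerSq T pSq μ η lbSq t := by
  obtain ⟨h1, h2⟩ := ctgSwitch_spec hT hγ1 hp hle
  rw [ctgPowerSq]
  set γ := gam μ η
  set ts := ctgSwitch T pSq μ η lbSq with hts
  split_ifs with h
  -- A zero lower bound would force the switch at time 0, leaving this first phase empty.
  · refine ⟨lt_of_le_of_ne hlb ?_, le_rfl⟩
    rintro rfl
    rw [ctgSwitch_eq_zero hT hγ] at hts
    omega
  · have hb := remaining_budget_pos h1 hp hle
    have hs : 0 < ∑ l ∈ Finset.Ico ts T, γ ^ (T - l - 1) :=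
      Finset.sum_pos (fun l _ => by positivity) ⟨ts, by simp [h1]⟩
    rw [← sum_pow_Ico_eq hγ1.ne] at h2
    refine ⟨by positivity, ?_⟩
    -- In the second phase the powers increase with $t$, so the worst case is the switching time,
    -- where the bound is the switching criterion itself.
    have h3 : γ ^ (T - 1 - ts) ≤ γ ^ (T - 1 - t) :=
      pow_le_pow_of_le_one hγ.le hγ1.le (by omega)
    have h4 := h2.le.trans h3
    rw [← mul_div_assoc, div_le_iff₀ hb] at h4
    rw [div_mul_eq_mul_div, le_div_iff₀ hs]
    linarith

theorem ctg_sq (hT : 1 ≤ T) (hγ : 0 < gam μ η) (hγ1 : gam μ η < 1) (hp : 0 < pSq)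
    (hle : lbSq ≤ pSq) (hlb : 0 ≤ lbSq) {t : ℕ} (ht : t < T) :
    ctg T pSq μ η lbSq t ^ 2 = ctgPowerSq T pSq μ η lbSq t :=
  Real.sq_sqrt (ctgPowerSq_bounds hT hγ hγ1 hp hle hlb ht).1.le

/-- The weighted inverse power of the `CtG` allocation. -/
theorem sum_pow_div_ctgPowerSq (hT : 1 ≤ T) (hγ : 0 < gam μ η) (hγ1 : gam μ η < 1)
    (hp : 0 < pSq) (hle : lbSq ≤ pSq) :
    ∑ t ∈ Finset.range T, gam μ η ^ (2 * (T - t - 1)) / ctgPowerSq T pSq μ η lbSq t =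
      (∑ t ∈ Finset.range (ctgSwitch T pSq μ η lbSq), gam μ η ^ (2 * (T - t - 1))) / lbSq +
        (∑ t ∈ Finset.Ico (ctgSwitch T pSq μ η lbSq) T, gam μ η ^ (T - t - 1)) ^ 2 /
          (T * pSq - ctgSwitch T pSq μ η lbSq * lbSq) := by
  have h1 := (ctgSwitch_spec hT hγ1 hp hle).1
  have hb := remaining_budget_pos h1 hp hle
  simp only [ctgPowerSq]
  set γ := gam μ η
  set ts := ctgSwitch T pSq μ η lbSq with hts
  have hs : 0 < ∑ l ∈ Finset.Ico ts T, γ ^ (T - l - 1) :=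
    Finset.sum_pos (fun l _ => by positivity) ⟨ts, by simp [h1]⟩
  rw [← Finset.sum_range_add_sum_Ico _ h1.le, Finset.sum_div]
  congr 1
  · refine Finset.sum_congr rfl fun t ht => ?_
    rw [if_pos (Finset.mem_range.1 ht)]
  -- The power is proportional to $\gamma^{T-1-t}$, which cancels one of the two factors
  -- $\gamma^{T-t-1}$ and leaves the normalizing sum, hence a square.
  · rw [sq, mul_div_assoc, Finset.sum_mul]
    refine Finset.sum_congr rfl fun t ht => ?_
    rw [if_neg (not_lt.2 (Finset.mem_Ico.1 ht).1)]
    have e : T - t - 1 = T - 1 - t := by omega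
    rw [e, two_mul, pow_add]
    field_simp

end AllocationBounds

/-- A function differentiable and bounded on a set is integrable along a random variable that
stays in this set. -/
theorem integrable_comp_of_ae_mem {E : Type*} [NormedAddCommGroup E] [NormedSpace ℝ E]
    [MeasurableSpace E] [BorelSpace E] {f : E → ℝ} {Ω : Type*} [MeasurableSpace Ω]
    {P : Measure Ω} [IsFiniteMeasure P] {F : Set E} {X : Ω → E} {C : ℝ}
    (hX : Measurable X) (hXF : ∀ᵐ ω ∂P, X ω ∈ F) (hdiff : ∀ x ∈ F, DifferentiableAt ℝ f x)
    (hC : ∀ x ∈ F, |f x| ≤ C) : Integrable (fun ω => f (X ω)) P := by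
  classical
  -- No measurability of $f$ is assumed. Its differentiability set is measurable and $f$ is
  -- continuous there, so cutting $f$ off outside gives a measurable version.
  have hm : MeasurableSet {x | DifferentiableAt ℝ f x} := measurableSet_of_differentiableAt ℝ f
  have hpw : Measurable ({x | DifferentiableAt ℝ f x}.piecewise f 0) := by
    refine ContinuousOn.measurable_piecewise ?_ continuousOn_const hm
    exact fun x hx => (DifferentiableAt.continuousAt hx).continuousWithinAt
  have hae : ∀ᵐ ω ∂P, {x | DifferentiableAt ℝ f x}.piecewise f 0 (X ω) = f (X ω) := by
    filter_upwards [hXF] with ω hω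
    exact Set.piecewise_eq_of_mem _ _ _ (hdiff _ hω)
  refine Integrable.of_bound (C := C) ((hpw.comp hX).aestronglyMeasurable.congr hae) ?_
  filter_upwards [hXF] with ω hω using hC _ hω

/-! ### Gradient descent with independent centered noise -/

section NoisyDescent

variable {E : Type*} [NormedAddCommGroup E] [InnerProductSpace ℝ E]

/-- One step of inexact gradient descent from a quadratic upper bound: a bound without
cancellation between the gradient and the error. -/
theorem descent_step_le {a b L η : ℝ} {g e : E} (hη : 0 ≤ η) (hLη : 2 * L * η ≤ 1)
    (h : b ≤ a + inner ℝ g (-(η • (g + e))) + L * ‖-(η • (g + e))‖ ^ 2) :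
    b ≤ a - η / 2 * ‖g‖ ^ 2 + η / 2 * ‖e‖ ^ 2 := by
  rw [inner_neg_right, inner_smul_right, inner_add_right, real_inner_self_eq_norm_sq, norm_neg,
    norm_smul, mul_pow, norm_add_sq_real, Real.norm_eq_abs, sq_abs] at h
  have h1 : 0 ≤ ‖g + e‖ ^ 2 := sq_nonneg _
  rw [norm_add_sq_real] at h1
  -- This replaces $L\eta^2\|g+e\|^2$ by $\tfrac\eta2\|g+e\|^2$, after which the inner products
  -- $\langle g,e\rangle$ cancel.
  have h2 : 0 ≤ η * (1 - 2 * L * η) := mul_nonneg hη (by linarith)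
  nlinarith [mul_nonneg h2 h1]

/-- One step of inexact gradient descent under gradient domination. -/
theorem descent_step_contraction {a b c L μ η : ℝ} {g e : E} (hη : 0 ≤ η)
    (hLη : 4 * L * η ≤ 1) (hμ : 2 * μ * (a - c) ≤ ‖g‖ ^ 2)
    (h : b ≤ a + inner ℝ g (-(η • (g + e))) + L * ‖-(η • (g + e))‖ ^ 2) :
    b - c ≤ (1 - μ * η) * (a - c) - η * (1 - 2 * L * η) * inner ℝ g e + L * η ^ 2 * ‖e‖ ^ 2 := by
  rw [inner_neg_right, inner_smul_right, inner_add_right, real_inner_self_eq_norm_sq, norm_neg,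
    norm_smul, mul_pow, norm_add_sq_real, Real.norm_eq_abs, sq_abs] at h
  -- At least $\tfrac\eta2\|g\|^2$ of descent remains for gradient domination. The term $\langle
  -- g,e\rangle$ is kept linear so that its mean can vanish.
  have h1 : L * η * (η * ‖g‖ ^ 2) ≤ 1 / 4 * (η * ‖g‖ ^ 2) :=
    mul_le_mul_of_nonneg_right (by linarith) (by positivity)
  have h2 := mul_le_mul_of_nonneg_left hμ hη
  have h3 : 0 ≤ η * ‖g‖ ^ 2 := by positivity
  nlinarith

variable [CompleteSpace E] {f : E → ℝ} {G η : ℝ} {s : ℕ → ℝ} {x₀ : E}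

theorem pagd_succ (hG : G ≠ 0) {t : ℕ} (hs : s t ≠ 0) (ν : ℕ → E) :
    pagd f G η s x₀ ν (t + 1) = pagd f G η s x₀ ν t +
      -(η • (gradient f (pagd f G η s x₀ ν t) + (G / s t) • ν t)) := by
  rw [pagd, dec, enc, smul_add, smul_smul, smul_smul, ← sub_eq_add_neg]
  congr 3
  have : G / s t * (s t * G⁻¹) = 1 := by field_simp
  rw [← smul_smul, ← smul_smul, smul_smul (s t), smul_smul, this, one_smul]

theorem pagd_congr {ν ν' : ℕ → E} {t : ℕ} (h : ∀ i < t, ν i = ν' i) :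
    pagd f G η s x₀ ν t = pagd f G η s x₀ ν' t := by
  induction t with
  | zero => rfl
  | succ t ih => rw [pagd, pagd, ih fun i hi => h i (hi.trans (Nat.lt_succ_self t)),
      h t (Nat.lt_succ_self t)]

variable [MeasurableSpace E] [BorelSpace E]

theorem measurable_gradient (f : E → ℝ) : Measurable (gradient f) := by
  have : Measurable (fderiv ℝ f) := measurable_fderiv ℝ f
  exact ((InnerProductSpace.toDual ℝ E).symm.continuous.measurable).comp this

variable [SecondCountableTopology E]

theorem measurable_pagd (t : ℕ) : Measurable fun ν : ℕ → E => pagd f G η s x₀ ν t := by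
  induction t with
  | zero => exact measurable_const
  | succ t ih =>
    have h1 : Measurable fun ν : ℕ → E => ν t := measurable_pi_apply t
    have h2 := (measurable_gradient f).comp ih
    simp only [pagd, enc, dec]
    exact ih.sub (((((h2.const_smul _).const_smul _).add h1).const_smul _).const_smul _)

variable {Ω : Type*} [MeasurableSpace Ω] {P : Measure Ω} {ν : ℕ → Ω → E}

/-- The iterate at time `t` is independent of the noise at time `t`. -/
theorem indepFun_pagd (hν : ∀ t, Measurable (ν t)) (hind : iIndepFun ν P) (t : ℕ) :
    IndepFun (fun ω => pagd f G η s x₀ (fun i => ν i ω) t) (ν t) P := by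
  have h := hind.indepFun_finset (Finset.range t) {t} (by simp) hν
  -- The iterate at time $t$ sees only the noises before $t$; padding by zero exhibits it as a
  -- measurable function of that finite block.
  let ext : (Finset.range t → E) → ℕ → E := fun y i =>
    if hi : i ∈ Finset.range t then y ⟨i, hi⟩ else 0
  have hext : Measurable ext := by
    refine measurable_pi_lambda _ fun i => ?_
    by_cases hi : i ∈ Finset.range t
    · simp only [ext, dif_pos hi]
      exact measurable_pi_apply _
    · simp only [ext, dif_neg hi]
      exact measurable_const
  have h2 := h.comp ((measurable_pagd (f := f) (G := G) (η := η) (s := s) (x₀ := x₀) t).comp hext)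
    (measurable_pi_apply (⟨t, Finset.mem_singleton_self t⟩ : ({t} : Finset ℕ)))
  have e : (fun ω => pagd f G η s x₀ (fun i => ν i ω) t) =
      fun ω => pagd f G η s x₀ (ext fun i => ν i ω) t := by
    funext ω
    refine pagd_congr fun i hi => ?_
    simp only [ext, dif_pos (Finset.mem_range.2 hi)]
  rw [e]
  exact h2

/-- Expected progress of one step of gradient descent with independent centered noise. -/
theorem integral_descent_step [IsProbabilityMeasure P] {F : Set E} {X Y N : Ω → E}
    {C C' Δ v c a b q fopt : ℝ} (hX : Measurable X) (hN : Measurable N) (hind : IndepFun X N P)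
    (hXF : ∀ᵐ ω ∂P, X ω ∈ F) (hdiff : ∀ x ∈ F, DifferentiableAt ℝ f x)
    (hC : ∀ x ∈ F, |f x| ≤ C) (hC' : ∀ x ∈ F, ‖gradient f x‖ ≤ C')
    (hΔ : ∀ᵐ ω ∂P, ‖N ω‖ ≤ Δ) (hmean : ∫ ω, N ω ∂P = 0) (hvar : ∫ ω, ‖N ω‖ ^ 2 ∂P = v)
    (hY : Integrable (fun ω => f (Y ω)) P)
    (hstep : ∀ᵐ ω ∂P, f (Y ω) - fopt ≤ q * (f (X ω) - fopt) -
      a * inner ℝ (gradient f (X ω)) (c • N ω) + b * ‖c • N ω‖ ^ 2) :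
    ∫ ω, (f (Y ω) - fopt) ∂P ≤ q * ∫ ω, (f (X ω) - fopt) ∂P + b * c ^ 2 * v := by
  have hfX := integrable_comp_of_ae_mem hX hXF hdiff hC
  have hNint : Integrable N P := Integrable.of_bound hN.aestronglyMeasurable Δ hΔ
  have hg : Measurable fun ω => gradient f (X ω) := (measurable_gradient f).comp hX
  have hgint : Integrable (fun ω => gradient f (X ω)) P :=
    Integrable.of_bound hg.aestronglyMeasurable C' (by
      filter_upwards [hXF] with ω hω using hC' _ hω)
  have hindg : IndepFun (fun ω => gradient f (X ω)) N P :=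
    hind.comp (measurable_gradient f) measurable_id
  have hinner : Integrable (fun ω => inner ℝ (gradient f (X ω)) (N ω)) P :=
    hindg.integrable_bilin hgint hNint (innerSL ℝ)
  have hinner0 : ∫ ω, inner ℝ (gradient f (X ω)) (N ω) ∂P = 0 := by
    have := hindg.integral_bilin hgint hNint (innerSL ℝ)
    rw [hmean, map_zero] at this
    exact this
  have hsq : Integrable (fun ω => ‖N ω‖ ^ 2) P :=
    Integrable.of_bound (hN.norm.pow_const 2).aestronglyMeasurable (Δ ^ 2) (by
      filter_upwards [hΔ] with ω hω
      rw [Real.norm_eq_abs, abs_of_nonneg (sq_nonneg _)]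
      gcongr)
  have hI1 : Integrable (fun ω => q * (f (X ω) - fopt)) P :=
    (hfX.sub (integrable_const _)).const_mul _
  have hI2 : Integrable (fun ω => a * c * inner ℝ (gradient f (X ω)) (N ω)) P :=
    hinner.const_mul _
  have hI12 : Integrable (fun ω => q * (f (X ω) - fopt) -
      a * c * inner ℝ (gradient f (X ω)) (N ω)) P := hI1.sub hI2
  have hI3 : Integrable (fun ω => b * c ^ 2 * ‖N ω‖ ^ 2) P := hsq.const_mul _
  have hle : ∫ ω, (f (Y ω) - fopt) ∂P ≤ ∫ ω, (q * (f (X ω) - fopt) -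
      a * c * inner ℝ (gradient f (X ω)) (N ω) + b * c ^ 2 * ‖N ω‖ ^ 2) ∂P := by
    refine integral_mono_ae (hY.sub (integrable_const _)) (hI12.add hI3) ?_
    filter_upwards [hstep] with ω hω
    rw [inner_smul_right, norm_smul, mul_pow, Real.norm_eq_abs, sq_abs] at hω
    refine hω.trans (le_of_eq ?_)
    ring
  refine hle.trans (le_of_eq ?_)
  rw [integral_add hI12 hI3, integral_sub hI1 hI2, integral_const_mul,
    integral_const_mul, integral_const_mul, hinner0, hvar]
  ring

end NoisyDescent

theorem le_of_affine_recursion {a b : ℕ → ℝ} {q : ℝ} (hq : 0 ≤ q) {T : ℕ}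
    (h : ∀ t < T, a (t + 1) ≤ q * a t + b t) :
    a T ≤ q ^ T * a 0 + ∑ t ∈ Finset.range T, q ^ (T - t - 1) * b t := by
  induction T with
  | zero => simp
  | succ T ih =>
    have h1 := ih fun t ht => h t (ht.trans (Nat.lt_succ_self T))
    have h2 := mul_le_mul_of_nonneg_left h1 hq
    have h3 := h T (Nat.lt_succ_self T)
    have h4 : ∑ t ∈ Finset.range T, q ^ (T + 1 - t - 1) * b t =
        q * ∑ t ∈ Finset.range T, q ^ (T - t - 1) * b t := by
      rw [Finset.mul_sum]
      refine Finset.sum_congr rfl fun t ht => ?_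
      have : T + 1 - t - 1 = (T - t - 1) + 1 := by
        have := Finset.mem_range.1 ht
        omega
      rw [this, pow_succ]
      ring
    rw [Finset.sum_range_succ, h4]
    simp only [Nat.add_sub_cancel_left, Nat.sub_self, pow_zero, one_mul]
    rw [pow_succ]
    linarith

end LQRPower

namespace LQRPower

/-- Convergence of power-allocated gradient descent with bounded, independent, centered channel
noise, on a set `F` that is invariant under steps with small error and on which `f` is gradient
dominated and has a quadratic upper bound along such steps. -/
theorem pagd_convergence {E : Type*} [NormedAddCommGroup E] [InnerProductSpace ℝ E]
    [CompleteSpace E] [MeasurableSpace E] [BorelSpace E] [SecondCountableTopology E]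
    {Ω : Type*} [MeasurableSpace Ω] {P : Measure Ω} [IsProbabilityMeasure P]
    {f : E → ℝ} {F : Set E} {G η L μ ε C C' Δ v fopt : ℝ} {s : ℕ → ℝ} {x₀ : E} {T : ℕ}
    {ν : ℕ → Ω → E} (hG : G ≠ 0) (hη : 0 ≤ η) (hLη : 4 * L * η ≤ 1) (hμη : μ * η ≤ 1)
    (hs : ∀ t < T, s t ≠ 0) (hx₀ : x₀ ∈ F) (hdiff : ∀ x ∈ F, DifferentiableAt ℝ f x)
    (hC : ∀ x ∈ F, |f x| ≤ C) (hC' : ∀ x ∈ F, ‖gradient f x‖ ≤ C')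
    (hPL : ∀ x ∈ F, 2 * μ * (f x - fopt) ≤ ‖gradient f x‖ ^ 2)
    (hquad : ∀ x ∈ F, ∀ e : E, ‖e‖ ^ 2 ≤ ε → x + -(η • (gradient f x + e)) ∈ F ∧
      f (x + -(η • (gradient f x + e))) ≤ f x +
        inner ℝ (gradient f x) (-(η • (gradient f x + e))) +
        L * ‖-(η • (gradient f x + e))‖ ^ 2)
    (hν : ∀ t, Measurable (ν t)) (hind : iIndepFun ν P) (hmean : ∀ t < T, ∫ ω, ν t ω ∂P = 0)
    (hvar : ∀ t < T, ∫ ω, ‖ν t ω‖ ^ 2 ∂P = v) (hΔ : ∀ t < T, ∀ᵐ ω ∂P, ‖ν t ω‖ ≤ Δ)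
    (hε : ∀ t < T, ∀ᵐ ω ∂P, ‖(G / s t) • ν t ω‖ ^ 2 ≤ ε) :
    (∀ᵐ ω ∂P, ∀ t ≤ T, pagd f G η s x₀ (fun i => ν i ω) t ∈ F) ∧
    Integrable (fun ω => f (pagd f G η s x₀ (fun i => ν i ω) T)) P ∧
    ∫ ω, (f (pagd f G η s x₀ (fun i => ν i ω) T) - fopt) ∂P ≤
      (1 - μ * η) ^ T * (f x₀ - fopt) +
        ∑ t ∈ Finset.range T, (1 - μ * η) ^ (T - t - 1) * (L * η ^ 2 * (G / s t) ^ 2 * v) := by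
  set X : ℕ → Ω → E := fun t ω => pagd f G η s x₀ (fun i => ν i ω) t with hX
  have hXmeas : ∀ t, Measurable (X t) := fun t =>
    (measurable_pagd t).comp (measurable_pi_lambda _ hν)
  have hε' : ∀ᵐ ω ∂P, ∀ t, t < T → ‖(G / s t) • ν t ω‖ ^ 2 ≤ ε := by
    rw [ae_all_iff]
    intro t
    by_cases ht : t < T
    · filter_upwards [hε t ht] with ω hω using fun _ => hω
    · exact Filter.Eventually.of_forall fun ω h => absurd h ht
  have hmem : ∀ᵐ ω ∂P, ∀ t ≤ T, X t ω ∈ F := by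
    filter_upwards [hε'] with ω hω
    intro t
    induction t with
    | zero => exact fun _ => hx₀
    | succ t ih =>
      intro ht
      simp only [hX]
      rw [pagd_succ hG (hs t ht)]
      exact (hquad _ (ih (by omega)) _ (hω t ht)).1
  have hint : ∀ t ≤ T, Integrable (fun ω => f (X t ω)) P := fun t ht =>
    integrable_comp_of_ae_mem (hXmeas t) (by filter_upwards [hmem] with ω hω using hω t ht)
      hdiff hC
  refine ⟨hmem, hint T le_rfl, ?_⟩
  have hrec := le_of_affine_recursion (a := fun t => ∫ ω, (f (X t ω) - fopt) ∂P)
    (b := fun t => L * η ^ 2 * (G / s t) ^ 2 * v) (q := 1 - μ * η) (T := T) (by linarith)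
    fun t ht => by
      refine integral_descent_step (a := η * (1 - 2 * L * η)) (hXmeas t) (hν t)
        (indepFun_pagd hν hind t) (by filter_upwards [hmem] with ω hω using hω t ht.le) hdiff hC
        hC' (hΔ t ht) (hmean t ht) (hvar t ht) (hint (t + 1) ht) ?_
      filter_upwards [hmem, hε'] with ω hω hω'
      have hx := hω t ht.le
      have hstep : X (t + 1) ω =
          X t ω + -(η • (gradient f (X t ω) + (G / s t) • ν t ω)) :=
        pagd_succ hG (hs t ht) _
      rw [hstep]
      exact descent_step_contraction hη hLη (hPL _ hx) (hquad _ hx _ (hω' t ht)).2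
  refine hrec.trans (le_of_eq ?_)
  congr 2
  simp [hX, pagd]

/-! ### Landscape constants and invariance of the feasible set -/

namespace LQR

open Matrix

variable {n m : ℕ} {S : LQR n m} {β₀ σw ψ J ζ : ℝ} {K : Gain m n}

open scoped Matrix.Norms.L2Operator in
theorem dotProduct_mulVec_self_le {k l : ℕ} {M : Matrix (Fin k) (Fin l) ℝ} {c : ℝ}
    (h : ‖M‖ ≤ c) (x : Fin l → ℝ) : (M *ᵥ x) ⬝ᵥ (M *ᵥ x) ≤ c ^ 2 * (x ⬝ᵥ x) := by
  have e : ∀ {j : ℕ} (y : Fin j → ℝ), y ⬝ᵥ y = ‖WithLp.toLp 2 y‖ ^ 2 := fun y => by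
    rw [EuclideanSpace.real_norm_sq_eq]
    simp [dotProduct, sq]
  have h1 : ‖WithLp.toLp 2 (M *ᵥ x)‖ ≤ ‖M‖ * ‖WithLp.toLp 2 x‖ :=
    Matrix.l2_opNorm_mulVec M (WithLp.toLp 2 x)
  rw [e, e, ← mul_pow]
  exact pow_le_pow_left₀ (norm_nonneg _) (h1.trans (by gcongr)) 2

theorem psd_of_sub_smul_one {k : ℕ} {M : Matrix (Fin k) (Fin k) ℝ} {c : ℝ} (hc : 0 ≤ c)
    (h : (M - c • (1 : Matrix (Fin k) (Fin k) ℝ)).PosSemidef) : M.PosSemidef := by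
  have := h.add (Matrix.PosSemidef.one.smul hc)
  rwa [sub_add_cancel] at this

theorem le_quadForm_of_sub_smul_one {k : ℕ} {M : Matrix (Fin k) (Fin k) ℝ} {c : ℝ}
    (h : (M - c • (1 : Matrix (Fin k) (Fin k) ℝ)).PosSemidef) (x : Fin k → ℝ) :
    c * (x ⬝ᵥ x) ≤ x ⬝ᵥ M *ᵥ x := by
  have := quadForm_nonneg h x
  rw [sub_mulVec, smul_mulVec, one_mulVec, dotProduct_sub, dotProduct_smul, smul_eq_mul] at this
  linarith

theorem quadForm_le_of_smul_one_sub {k : ℕ} {M : Matrix (Fin k) (Fin k) ℝ} {c : ℝ}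
    (h : (c • (1 : Matrix (Fin k) (Fin k) ℝ) - M).PosSemidef) (x : Fin k → ℝ) :
    x ⬝ᵥ M *ᵥ x ≤ c * (x ⬝ᵥ x) := by
  have := quadForm_nonneg h x
  rw [sub_mulVec, smul_mulVec, one_mulVec, dotProduct_sub, dotProduct_smul, smul_eq_mul] at this
  linarith

open scoped Matrix.Norms.L2Operator in
theorem bounded_of_posSemidef (S : LQR n m) {β₁ : ℝ} (hn : n ≠ 0) (hβ₀ : 0 < β₀) (hβ₁ : β₁ ≤ 1)
    (hσw : 0 < σw) (hψ : 1 ≤ ψ)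
    (hR₀ : (S.R - β₀ • (1 : Matrix (Fin m) (Fin m) ℝ)).PosSemidef)
    (hR₁ : (β₁ • (1 : Matrix (Fin m) (Fin m) ℝ) - S.R).PosSemidef)
    (hQ₀ : (S.Q - β₀ • (1 : Matrix (Fin n) (Fin n) ℝ)).PosSemidef)
    (hQ₁ : (β₁ • (1 : Matrix (Fin n) (Fin n) ℝ) - S.Q).PosSemidef)
    (hW : (S.W - σw ^ 2 • (1 : Matrix (Fin n) (Fin n) ℝ)).PosSemidef)
    (hB : spectralNorm S.B ≤ ψ) : S.Bounded β₀ σw ψ where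
  pos := hβ₀
  le_one := by
    -- Testing both bounds on $Q$ at a basis vector gives $\beta_0\le\beta_1\le1$.
    let i : Fin n := ⟨0, Nat.pos_of_ne_zero hn⟩
    have h1 := le_quadForm_of_sub_smul_one hQ₀ (Pi.single i 1)
    have h2 := quadForm_le_of_smul_one_sub hQ₁ (Pi.single i 1)
    have e : (Pi.single i 1 : Fin n → ℝ) ⬝ᵥ Pi.single i 1 = 1 := by simp
    rw [e] at h1 h2
    linarith
  noise_pos := hσw
  one_le := hψ
  psdQ := psd_of_sub_smul_one hβ₀.le hQ₀
  psdR := psd_of_sub_smul_one hβ₀.le hR₀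
  psdW := psd_of_sub_smul_one (sq_nonneg _) hW
  le_Q := le_quadForm_of_sub_smul_one hQ₀
  le_R := le_quadForm_of_sub_smul_one hR₀
  R_le x := (quadForm_le_of_smul_one_sub hR₁ x).trans
    (mul_le_of_le_one_left (dotProduct_self_nonneg' x) hβ₁)
  le_W := le_quadForm_of_sub_smul_one hW
  B_le := dotProduct_mulVec_self_le hB
  Bt_le := dotProduct_mulVec_self_le (by
    rw [← conjTranspose_eq_transpose_of_trivial, Matrix.l2_opNorm_conjTranspose]
    exact hB)

theorem Bounded.cost_nonneg (hS : S.Bounded β₀ σw ψ) (hK : S.Stabilizing K) : 0 ≤ S.cost K :=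
  (mul_nonneg hS.pos.le (hS.stateCov_spec hK).1.trace_nonneg).trans (hS.trace_stateCov_le hK)

theorem Bounded.dimension_le_optCost (hS : S.Bounded β₀ σw ψ) (hK : S.Stabilizing K) :
    β₀ * σw ^ 2 * n ≤ S.optCost := by
  refine le_csInf ⟨_, K, hK, rfl⟩ ?_
  rintro _ ⟨_, hstab, rfl⟩
  exact hS.dimension_le_cost hstab

/-- Gradient domination on a sublevel set. -/
theorem Bounded.gradient_domination (hS : S.Bounded β₀ σw ψ) (hJ0 : 0 < J)
    (hK : S.Stabilizing K) (hJ : S.cost K ≤ J) (hζJ : J = β₀ * σw ^ 2 * ζ ^ 2) (hζ : 1 ≤ ζ) :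
    2 * (2 * J / ζ ^ 4) * (S.cost K - S.optCost) ≤ ‖S.policyGrad K‖ ^ 2 := by
  have hb := hS.pos
  have hw := hS.noise_pos
  have h1 : S.cost K - J / (4 * β₀ ^ 2 * σw ^ 4) * ‖S.policyGrad K‖ ^ 2 ≤ S.optCost := by
    refine le_csInf ⟨_, K, hK, rfl⟩ ?_
    rintro _ ⟨K', hK', rfl⟩
    rcases le_total (S.cost K') J with h | h
    -- Comparison gains of cost above $\bar J$ are trivial, since $J(K)\le\bar J$.
    · linarith [hS.cost_sub_le_norm_sq hK hK' h]
    · have : 0 ≤ J / (4 * β₀ ^ 2 * σw ^ 4) * ‖S.policyGrad K‖ ^ 2 := by positivity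
      linarith
  have e : 2 * (2 * J / ζ ^ 4) * (J / (4 * β₀ ^ 2 * σw ^ 4)) = 1 := by
    rw [hζJ]
    field_simp
    norm_num
  have h2 : 0 ≤ 2 * (2 * J / ζ ^ 4) := by positivity
  have h3 : S.cost K - S.optCost ≤ J / (4 * β₀ ^ 2 * σw ^ 4) * ‖S.policyGrad K‖ ^ 2 := by
    linarith
  calc _ ≤ _ := mul_le_mul_of_nonneg_left h3 h2
    _ = _ := by rw [← mul_assoc, e, one_mul]

theorem Bounded.norm_policyGrad_le (hS : S.Bounded β₀ σw ψ) (hJ0 : 0 < J)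
    (hK : S.Stabilizing K) (hJ : S.cost K ≤ J) :
    ‖S.policyGrad K‖ ≤ 2 * J / (β₀ * σw ^ 2) * √((σw ^ 2 + ψ ^ 2 * J) * J) := by
  have hb := hS.pos
  have hw := hS.noise_pos
  refine le_of_sq_le_sq ?_ (by positivity)
  refine (hS.norm_policyGrad_sq_le hK hJ).trans (le_of_eq ?_)
  rw [mul_pow, Real.sq_sqrt (by positivity)]
  field_simp
  norm_num

/-- Puts $G$ in the units of $L$, so that the step length can be compared with the radius of the
expansion. -/
theorem Bounded.gradient_scale_le (hS : S.Bounded β₀ σw ψ) (hJ0 : 0 < J) (hζ : 1 ≤ ζ)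
    (hζJ : J = β₀ * σw ^ 2 * ζ ^ 2) :
    2 * J / (β₀ * σw ^ 2) * √((σw ^ 2 + ψ ^ 2 * J) * J) ≤ 3 * ζ ^ 2 * ψ * (J / β₀) := by
  have hb := hS.pos
  have hb1 := hS.le_one
  have hw := hS.noise_pos
  have hψ := hS.one_le
  have e : 2 * J / (β₀ * σw ^ 2) = 2 * ζ ^ 2 := by rw [hζJ]; field_simp
  have h1 : σw ^ 2 ≤ J / β₀ := by
    rw [le_div_iff₀ hb, hζJ]
    have : 1 ≤ ζ ^ 2 := one_le_pow₀ hζ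
    nlinarith [mul_pos hb (pow_pos hw 2)]
  have h2 : J ≤ J / β₀ := by
    rw [le_div_iff₀ hb]
    nlinarith
  have hψ2 : 1 ≤ ψ ^ 2 := one_le_pow₀ hψ
  set s := J / β₀ with hs
  have hs0 : 0 < s := by positivity
  have h3 : √((σw ^ 2 + ψ ^ 2 * J) * J) ≤ 3 / 2 * ψ * s := by
    rw [Real.sqrt_le_left (by positivity)]
    calc (σw ^ 2 + ψ ^ 2 * J) * J ≤ (ψ ^ 2 * s + ψ ^ 2 * s) * s := by
          gcongr
          nlinarith
      _ ≤ (3 / 2 * ψ * s) ^ 2 := by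
          have : 0 ≤ ψ ^ 2 * s ^ 2 := by positivity
          nlinarith
  rw [e]
  have := mul_le_mul_of_nonneg_left h3 (by positivity : 0 ≤ 2 * ζ ^ 2)
  linarith

end LQR

end LQRPower

namespace LQRPower

namespace LQR

variable {n m : ℕ} {S : LQR n m} {β₀ σw ψ J ζ : ℝ} {K : Gain m n}

theorem Bounded.gradient_cost (hS : S.Bounded β₀ σw ψ) (hK : S.Stabilizing K)
    (hJ : S.cost K ≤ J) (hζ : 1 ≤ ζ) (hζJ : J = β₀ * σw ^ 2 * ζ ^ 2) :
    gradient S.cost K = S.policyGrad K :=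
  (hS.hasGradientAt_cost hK hJ hζ hζJ).gradient

/-- A gradient step with a small error stays in the feasible set and obeys the quadratic upper
bound of the cost. -/
theorem Bounded.feasible_step {μ L η : ℝ} (hS : S.Bounded β₀ σw ψ) (hJ0 : 0 < J)
    (hopt : S.optCost ≤ J / 4) (hζ : 1 ≤ ζ) (hζJ : J = β₀ * σw ^ 2 * ζ ^ 2)
    (hμ : μ = 2 * J / ζ ^ 4) (hL : 58 * ψ ^ 2 * ζ ^ 5 * (J / β₀) ≤ L) (hη : 0 ≤ η)
    (hLη : 4 * L * η ≤ 1) (hμη : μ * η ≤ 1) (hK : K ∈ S.feasible J) {e : Gain m n}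
    (he : ‖e‖ ^ 2 ≤ μ * J / 2) :
    K + -(η • (gradient S.cost K + e)) ∈ S.feasible J ∧
      S.cost (K + -(η • (gradient S.cost K + e))) ≤ S.cost K +
        inner ℝ (gradient S.cost K) (-(η • (gradient S.cost K + e))) +
        L * ‖-(η • (gradient S.cost K + e))‖ ^ 2 := by
  obtain ⟨hKs, hKJ⟩ := hK
  rw [hS.gradient_cost hKs hKJ hζ hζJ]
  set g := S.policyGrad K with hg
  set d := -(η • (g + e)) with hd
  have hb := hS.pos
  have hb1 := hS.le_one
  have hψ := hS.one_le
  have hs0 : 0 < J / β₀ := by positivity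
  have hJs : J ≤ J / β₀ := by
    rw [le_div_iff₀ hb]
    nlinarith
  have hgn : ‖g‖ ≤ 3 * ζ ^ 2 * ψ * (J / β₀) :=
    (hS.norm_policyGrad_le hJ0 hKs hKJ).trans (hS.gradient_scale_le hJ0 hζ hζJ)
  have hen : ‖e‖ ≤ ζ ^ 2 * ψ * (J / β₀) := by
    have h1 : ‖e‖ ≤ J := by
      refine le_of_sq_le_sq (he.trans ?_) hJ0.le
      rw [hμ]
      have h2 : 2 * J / ζ ^ 4 * J / 2 = J ^ 2 / ζ ^ 4 := by field_simp
      rw [h2]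
      exact div_le_self (by positivity) (one_le_pow₀ hζ)
    have h3 : 1 ≤ ζ ^ 2 * ψ := one_le_mul_of_one_le_of_one_le (one_le_pow₀ hζ) hψ
    calc ‖e‖ ≤ 1 * (J / β₀) := by linarith
      _ ≤ _ := by gcongr
  have hdn : ‖d‖ ≤ η * (4 * ζ ^ 2 * ψ * (J / β₀)) := by
    rw [hd, norm_neg, norm_smul, Real.norm_eq_abs, abs_of_nonneg hη]
    have := norm_add_le g e
    gcongr
    linarith
  -- The scale 4 (3 from the gradient, 1 from the error) times 6 is $24\le58$, so the quantity is at
  -- most $L\eta\le1/4$.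
  have hsmall : 6 * (ψ * ‖d‖ * ζ ^ 3) ≤ 1 := by
    calc 6 * (ψ * ‖d‖ * ζ ^ 3) ≤ 6 * (ψ * (η * (4 * ζ ^ 2 * ψ * (J / β₀))) * ζ ^ 3) := by gcongr
      _ = 24 * (ψ ^ 2 * ζ ^ 5 * (J / β₀)) * η := by ring
      _ ≤ 58 * (ψ ^ 2 * ζ ^ 5 * (J / β₀)) * η := by gcongr; norm_num
      _ = (58 * ψ ^ 2 * ζ ^ 5 * (J / β₀)) * η := by ring
      _ ≤ L * η := by gcongr
      _ ≤ 1 := by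
        have : 0 ≤ L * η := mul_nonneg (le_trans (by positivity) hL) hη
        linarith
  have hstab := hS.stabilizing_add hKs hKJ hζ hζJ hsmall
  have hquad : S.cost (K + d) ≤ S.cost K + inner ℝ g d + L * ‖d‖ ^ 2 := by
    have h1 := (abs_le.1 (hS.abs_cost_sub_inner_le hKs hKJ hζ hζJ hsmall)).2
    have h2 : 58 * ψ ^ 2 * ζ ^ 5 * (J / β₀) * ‖d‖ ^ 2 ≤ L * ‖d‖ ^ 2 := by gcongr
    linarith
  refine ⟨⟨hstab, ?_⟩, hquad⟩
  have hL0 : 0 ≤ L * η := mul_nonneg (le_trans (by positivity) hL) hη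
  -- Domination turns this into $(1-\mu\eta)(J(K)-J^\star)+J^\star+\tfrac14\mu\eta\bar J$; then
  -- $J(K)\le\bar J$ and $J^\star\le\bar J/4$ suffice.
  have h3 := descent_step_le hη (by linarith) hquad
  have h4 := hS.gradient_domination hJ0 hKs hKJ hζJ hζ
  rw [← hμ, ← hg] at h4
  have h5 := mul_le_mul_of_nonneg_left h4 hη
  have h6 := mul_le_mul_of_nonneg_left he hη
  have h7 : (1 - μ * η) * (S.cost K - S.optCost) ≤ (1 - μ * η) * (J - S.optCost) :=
    mul_le_mul_of_nonneg_left (by linarith) (by linarith)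
  have hμη0 : 0 ≤ μ * η := by rw [hμ]; positivity
  have h8 := mul_le_mul_of_nonneg_left hopt hμη0
  have h9 : 0 ≤ μ * η * J := by positivity
  linarith

end LQR

end LQRPower

/-! ### Assembly of the main theorem -/

theorem mainTheorem3 {n m : ℕ} (S : LQRPower.LQR n m)
    -- bounds on the problem data
    (β₀ β₁ σw ψ Jbar : ℝ) (hβ₀ : 0 < β₀) (hβ₁ : β₁ ≤ 1) (hσw : 0 < σw) (hψ : 1 ≤ ψ)
    (hJbar : 0 < Jbar)
    (hR₀ : (S.R - β₀ • (1 : Matrix (Fin m) (Fin m) ℝ)).PosSemidef)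
    (hR₁ : (β₁ • (1 : Matrix (Fin m) (Fin m) ℝ) - S.R).PosSemidef)
    (hQ₀ : (S.Q - β₀ • (1 : Matrix (Fin n) (Fin n) ℝ)).PosSemidef)
    (hQ₁ : (β₁ • (1 : Matrix (Fin n) (Fin n) ℝ) - S.Q).PosSemidef)
    (hW : (S.W - σw ^ 2 • (1 : Matrix (Fin n) (Fin n) ℝ)).PosSemidef)
    (hB : LQRPower.spectralNorm S.B ≤ ψ)
    (hopt : S.optCost ≤ Jbar / 4)
    -- landscape constants
    (ζ μ L G D : ℝ)
    (hζ : ζ = √(Jbar / (β₀ * σw ^ 2)))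
    (hμ : μ = 2 * Jbar / ζ ^ 4)
    (hL : L = 112 * √(n : ℝ) * Jbar * ψ ^ 2 * ζ ^ 8 / β₀)
    (hG : G = 2 * Jbar / (β₀ * σw ^ 2) * √((σw ^ 2 + ψ ^ 2 * Jbar) * Jbar))
    (hD : D = 1 / (ψ * ζ ^ 3))
    -- horizon, step size, initial gain
    (T : ℕ) (hT : 1 ≤ T) (η : ℝ) (hη₀ : 0 < η) (hη : η < min (D / G) (1 / (4 * L)))
    (K₀ : LQRPower.Gain m n) (hK₀ : K₀ ∈ S.feasible Jbar)
    -- channel noise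
    {Ω : Type*} [MeasurableSpace Ω] (P : MeasureTheory.Measure Ω)
    [MeasureTheory.IsProbabilityMeasure P]
    (ν : ℕ → Ω → LQRPower.Gain m n) (hν : ∀ t, Measurable (ν t))
    (hindep : ProbabilityTheory.iIndepFun ν P)
    (hmean : ∀ t, ∫ ω, ν t ω ∂P = 0)
    (σN : ℝ) (hvar : ∀ t, ∫ ω, ‖ν t ω‖ ^ 2 ∂P = σN ^ 2)
    (Δ : ℝ) (hΔ : ∀ t < T, ∀ᵐ ω ∂P, ‖ν t ω‖ ≤ Δ)
    -- power lower bound and power budget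
    (lbSq : ℝ) (hlb : lbSq = G ^ 2 * Δ ^ 2 * max (η ^ 2 / (D - G * η) ^ 2) (2 / (μ * Jbar)))
    (σp : ℝ) (hσp : 0 < σp) (hbudget : lbSq ≤ σp ^ 2)
    -- switching time and iterates
    (ts : ℕ) (hts : ts = LQRPower.ctgSwitch T (σp ^ 2) μ η lbSq)
    (K : ℕ → Ω → LQRPower.Gain m n)
    (hK : ∀ t ω, K t ω =
      LQRPower.pagd S.cost G η (LQRPower.ctg T (σp ^ 2) μ η lbSq) K₀ (fun s => ν s ω) t) :
    (∀ᵐ ω ∂P, ∀ t ≤ T, K t ω ∈ S.feasible Jbar) ∧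
    MeasureTheory.Integrable (fun ω => S.cost (K T ω)) P ∧
    ∫ ω, (S.cost (K T ω) - S.optCost) ∂P ≤
      (1 - μ * η) ^ T * (S.cost K₀ - S.optCost) +
        L * G ^ 2 * η ^ 2 * σN ^ 2 *
          ((∑ t ∈ Finset.range ts, LQRPower.gam μ η ^ (2 * (T - t - 1))) / lbSq +
            (∑ t ∈ Finset.Ico ts T, LQRPower.gam μ η ^ (T - t - 1)) ^ 2 /
              (T * σp ^ 2 - ts * lbSq)) := by
  -- For $n=0$, $L=0$ and division by zero gives $1/(4L)=0$, contradicting $0<\eta<1/(4L)$.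
  have hn : n ≠ 0 := by
    rintro rfl
    have h1 : L = 0 := by rw [hL]; simp
    rw [h1, mul_zero, div_zero] at hη
    exact absurd (hη.trans_le (min_le_right _ _)) (not_lt.2 hη₀.le)
  have hS : S.Bounded β₀ σw ψ :=
    S.bounded_of_posSemidef hn hβ₀ hβ₁ hσw hψ hR₀ hR₁ hQ₀ hQ₁ hW hB
  have hn1 : (1 : ℝ) ≤ n := by exact_mod_cast Nat.one_le_iff_ne_zero.2 hn
  have hb1 := hS.le_one
  have hβσ : 0 < β₀ * σw ^ 2 := by positivity
  have hζJ : Jbar = β₀ * σw ^ 2 * ζ ^ 2 := by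
    rw [hζ, Real.sq_sqrt (by positivity)]
    field_simp
  -- Uses $\beta_0\sigma_w^2n\le J^\star\le\bar J/4$ with $n\ge1$.
  have hζ1 : 1 ≤ ζ := by
    rw [hζ, Real.one_le_sqrt, one_le_div hβσ]
    have h1 := hS.dimension_le_optCost hK₀.1
    nlinarith
  have hJs : Jbar ≤ Jbar / β₀ := by
    rw [le_div_iff₀ hβ₀]
    nlinarith
  have hsqrt : 1 ≤ √(n : ℝ) := Real.one_le_sqrt.2 hn1
  have hL' : L = 112 * √(n : ℝ) * ψ ^ 2 * ζ ^ 8 * (Jbar / β₀) := by rw [hL]; ring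
  have hLge : 112 * ψ ^ 2 * ζ ^ 8 * (Jbar / β₀) ≤ L := by
    rw [hL']
    have : 0 ≤ ψ ^ 2 * ζ ^ 8 * (Jbar / β₀) := by positivity
    nlinarith
  have hL58 : 58 * ψ ^ 2 * ζ ^ 5 * (Jbar / β₀) ≤ L := by
    refine le_trans ?_ hLge
    gcongr <;> norm_num
  have hL0 : 0 < L := lt_of_lt_of_le (by positivity) hL58
  have hμ0 : 0 < μ := by rw [hμ]; positivity
  have hLη : 4 * L * η < 1 := by
    have := hη.trans_le (min_le_right _ _)
    rw [lt_div_iff₀ (by positivity)] at this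
    linarith
  have hμL : μ ≤ L := by
    refine le_trans ?_ hLge
    have h1 : μ ≤ 2 * Jbar := by
      rw [hμ]
      exact div_le_self (by positivity) (one_le_pow₀ hζ1)
    have h2 : 1 ≤ ψ ^ 2 * ζ ^ 8 :=
      one_le_mul_of_one_le_of_one_le (one_le_pow₀ hψ) (one_le_pow₀ hζ1)
    have h3 : 1 * (Jbar / β₀) ≤ ψ ^ 2 * ζ ^ 8 * (Jbar / β₀) := by gcongr
    linarith
  have hμη : μ * η < 1 := by
    have h1 := mul_le_mul_of_nonneg_right hμL hη₀.le
    have h2 : 0 < L * η := by positivity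
    linarith
  have hμη0 : 0 < μ * η := by positivity
  have hG0 : 0 < G := by rw [hG]; positivity
  have hγsq : LQRPower.gam μ η ^ 2 = 1 - μ * η := Real.sq_sqrt (by linarith)
  have hγ0 : 0 < LQRPower.gam μ η := Real.sqrt_pos.2 (by linarith)
  have hγ1 : LQRPower.gam μ η < 1 := by
    rw [LQRPower.gam, Real.sqrt_lt' one_pos]
    linarith
  have hp : 0 < σp ^ 2 := by positivity
  have hlb0 : 0 ≤ lbSq := by
    rw [hlb]
    exact mul_nonneg (by positivity) (le_max_of_le_left (by positivity))
  -- The second entry of the maximum is what makes the decoded error at most $\mu\bar J/2$ in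
  -- squared norm.
  have hlb2 : 2 * (G ^ 2 * Δ ^ 2) ≤ lbSq * (μ * Jbar) := by
    have h1 : G ^ 2 * Δ ^ 2 * (2 / (μ * Jbar)) ≤ lbSq := by
      rw [hlb]
      exact mul_le_mul_of_nonneg_left (le_max_right _ _) (by positivity)
    rw [← mul_div_assoc, div_le_iff₀ (by positivity)] at h1
    linarith
  have hpow : ∀ t < T, 0 < LQRPower.ctgPowerSq T (σp ^ 2) μ η lbSq t ∧
      lbSq ≤ LQRPower.ctgPowerSq T (σp ^ 2) μ η lbSq t := fun t ht =>
    LQRPower.ctgPowerSq_bounds hT hγ0 hγ1 hp hbudget hlb0 ht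
  have hctg : ∀ t < T, LQRPower.ctg T (σp ^ 2) μ η lbSq t ^ 2 =
      LQRPower.ctgPowerSq T (σp ^ 2) μ η lbSq t := fun t ht =>
    LQRPower.ctg_sq hT hγ0 hγ1 hp hbudget hlb0 ht
  have hε : ∀ t < T, ∀ᵐ ω ∂P,
      ‖(G / LQRPower.ctg T (σp ^ 2) μ η lbSq t) • ν t ω‖ ^ 2 ≤ μ * Jbar / 2 := by
    intro t ht
    filter_upwards [hΔ t ht] with ω hω
    rw [norm_smul, mul_pow, Real.norm_eq_abs, sq_abs, div_pow, hctg t ht, div_mul_eq_mul_div,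
      div_le_iff₀ (hpow t ht).1]
    have h1 : G ^ 2 * ‖ν t ω‖ ^ 2 ≤ G ^ 2 * Δ ^ 2 := by gcongr
    have h2 := mul_le_mul_of_nonneg_right (hpow t ht).2 (by positivity : 0 ≤ μ * Jbar)
    linarith
  have main := LQRPower.pagd_convergence (f := S.cost) (F := S.feasible Jbar) (G := G) (η := η)
    (L := L) (μ := μ) (ε := μ * Jbar / 2) (C := Jbar) (C' := G) (Δ := Δ) (v := σN ^ 2)
    (fopt := S.optCost) (s := LQRPower.ctg T (σp ^ 2) μ η lbSq) (x₀ := K₀) (T := T) (ν := ν)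
    hG0.ne' hη₀.le hLη.le hμη.le
    (fun t ht h => by
      have := hctg t ht
      rw [h, zero_pow two_ne_zero] at this
      exact (hpow t ht).1.ne this)
    hK₀
    (fun x hx => (hS.hasGradientAt_cost hx.1 hx.2 hζ1 hζJ).differentiableAt)
    (fun x hx => by
      rw [abs_of_nonneg (hS.cost_nonneg hx.1)]
      exact hx.2)
    (fun x hx => by
      rw [hS.gradient_cost hx.1 hx.2 hζ1 hζJ, hG]
      exact hS.norm_policyGrad_le hJbar hx.1 hx.2)
    (fun x hx => by
      rw [hS.gradient_cost hx.1 hx.2 hζ1 hζJ, hμ]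
      exact hS.gradient_domination hJbar hx.1 hx.2 hζJ hζ1)
    (fun x hx e he => hS.feasible_step hJbar hopt hζ1 hζJ hμ hL58 hη₀.le hLη.le hμη.le hx he)
    hν hindep (fun t _ => hmean t) (fun t _ => hvar t) hΔ hε
  obtain ⟨hmem, hint, hbound⟩ := main
  simp only [hK]
  refine ⟨hmem, hint, hbound.trans (le_of_eq ?_)⟩
  congr 1
  rw [hts, ← LQRPower.sum_pow_div_ctgPowerSq hT hγ0 hγ1 hp hbudget, Finset.mul_sum]
  refine Finset.sum_congr rfl fun t ht => ?_
  rw [div_pow, hctg t (Finset.mem_range.1 ht), pow_mul, hγsq]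
  ring
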